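/- **Theorem 1 (An $O(1)$ ES estimator).** Let $H = D_0 + \sum_{j=1}^M D_jP_j$ be a Hermitian matrix on a finite-dimensional space with basis $\{|z\rangle\}$, in permutation-matrix-representation form: the $D_j$ are diagonal, and the $P_j$ are distinct non-identity elements of a permutation group that acts simply transitively on the basis. Let $\beta>0$. Write $\langle O\rangle = \mathrm{Tr}[Oe^{-\beta H}]/\mathrm{Tr}[e^{-\beta H}]$ and $O(\tau)=e^{\tau H}Oe^{-\tau H}$. A configuration $\mathcal C$ is a basis state $z$ with a sequence $P_{i_1},\dots,P_{i_q}$ ($q\ge 0$) such that $P_{i_q}\cdots P_{i_1}=\mathbb 1$. Put $|z_k\rangle=P_{i_k}\cdots P_{i_1}|z\rangle$, $E_{z_k}=\langle z_k|D_0|z_k\rangle$, let $e^{-\beta[x_0,\dots,x_k]}$ be the divided difference of $x\mapsto e^{-\beta x}$ at $x_0,\dots,x_k$, and $w_{\mathcal C}=\big(\prod_{k=1}^q\langle z_k|D_{i_k}|z_k\rangle\big)e^{-\beta[E_{z_0},\dots,E_{z_q}]}$. A configuration function $O_{\mathcal C}$ is an estimator of a number $v$, written $O_{\mathcal C}\mathrel{\widehat=}v$,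 if $\sum_{\mathcal C}w_{\mathcal C}$ and $\sum_{\mathcal C}w_{\mathcal C}O_{\mathcal C}$ converge absolutely, $\sum_{\mathcal C}w_{\mathcal C}\neq0$, and $v=\sum_{\mathcal C}w_{\mathcal C}O_{\mathcal C}/\sum_{\mathcal C}w_{\mathcal C}$. Then $e^{-\beta[E_{z_0},\dots,E_{z_q}]}\ne0$ for every configuration, and $$A_{\mathcal C}:=\beta E_{z_0}^2+qE_{z_0}+\mathbf 1_{q>0}\,\beta E_{z_0}\frac{e^{-\beta[E_{z_0},\dots,E_{z_{q-1}}]}}{e^{-\beta[E_{z_0},\dots,E_{z_q}]}}\;\mathrel{\widehat=}\;\int_0^\beta\langle D_0(\tau)D_0\rangle\,d\tau .$$ Moreover, let $H=H_0+\lambda H_1$ and $\chi_E^{H_1}=\int_0^\beta(\langle H_1(\tau)H_1\rangle-\langle H_1\rangle^2)\,d\tau$ (the energy susceptibility), and let $c\in\mathbb R$. Put $R_k=\mathbf 1_{q\ge k}\,e^{-\beta[E_{z_0},\dots,E_{z_{q-k}}]}/e^{-\beta[E_{z_0},\dots,E_{z_q}]}$. 1. If $H_1=cD_0$, then $c^2A_{\mathcal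 C}\mathrel{\widehat=}\int_0^\beta\langle H_1(\tau)H_1\rangle d\tau$ and $cE_{z_0}\mathrel{\widehat=}\langle H_1\rangle$. 2. If $H_1=c(H-D_0)$, then $c^2\big(\beta[E_{z_q}^2+(E_{z_q}+E_{z_{q-1}})R_1+R_2]+A_{\mathcal C}-2\beta E_{z_0}(E_{z_0}+R_1)\big)\mathrel{\widehat=}\int_0^\beta\langle H_1(\tau)H_1\rangle d\tau$ and $cR_1\mathrel{\widehat=}\langle H_1\rangle$ (the term with $E_{z_{q-1}}$ is absent for $q=0$). In both cases $\chi_E^{H_1}$ equals the weighted average of the first estimator minus $\beta$ times the square of the weighted average of the second. All these configuration functions are computable in $O(1)$ time: for each there is one program for a unit-cost register machine with exact arithmetic, independent of $H$, its dimension, $\beta$, $c$ and the configuration, that halts with its value within a fixed number of steps, given random access to $q$, $\beta$, $c$, the energies $E_{z_0},\dots,E_{z_q}$ and the divided differences $e^{-\beta[E_{z_0},\dots,E_{z_k}]}$, $0\le k\le q$. -/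

import Mathlib

open scoped Matrix

universe u

/-! ### Permutation-matrix-representation of a Hamiltonian -/

/-- A matrix `D₀ + ∑ j, D j * P j` in permutation matrix representation over the basis `ι`:
diagonal matrices (given by their diagonals) times distinct, non-identity permutations of the
basis, which belong to a permutation group acting simply transitively on the basis. -/
structure PMR (ι : Type*) (M : ℕ) where
  /-- the diagonal of `D₀` -/
  diag0 : ι → ℂ
  /-- the diagonal of `D j` -/
  diag : Fin M → ι → ℂ
  /-- the permutation `P j` -/
  perm : Fin M → Equiv.Perm ι
  /-- the permutation group that contains all the `P j` -/
  group : Subgroup (Equiv.Perm ι)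
  simply_transitive : ∀ z z' : ι, ∃! g : group, (g : Equiv.Perm ι) z = z'
  perm_mem : ∀ j, perm j ∈ group
  perm_injective : Function.Injective perm
  perm_ne_one : ∀ j, perm j ≠ 1

namespace PMR

section
variable {ι : Type*} [DecidableEq ι] {M : ℕ}

/-- The matrix of the permutation operator `|z⟩ ↦ |σ z⟩`. (Mathlib's `permMatrix σ` has its ones
at the entries `(i, σ i)`, so that it maps `|z⟩` to `|σ⁻¹ z⟩`.) -/
def permOp (σ : Equiv.Perm ι) : Matrix ι ι ℂ := (σ⁻¹).permMatrix ℂ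

/-- The diagonal part `D₀` as a matrix. -/
def diagPart (P : PMR ι M) : Matrix ι ι ℂ := Matrix.diagonal P.diag0

/-- The matrix `H = D₀ + ∑ j, D j * P j`. -/
def matrix [Fintype ι] (P : PMR ι M) : Matrix ι ι ℂ :=
  P.diagPart + ∑ j, Matrix.diagonal (P.diag j) * permOp (P.perm j)

end

/-- The product `P_{i_k} ⋯ P_{i_1}` of the first `k` permutations of a sequence of length `q`
(the sequence is indexed from `0`, so that `P_{i_{k+1}}` is `P.perm (idx k)`). -/
def partialProd {ι : Type*} {M : ℕ} (P : PMR ι M) {q : ℕ} (idx : Fin q → Fin M) :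
    ℕ → Equiv.Perm ι
  | 0 => 1
  | k + 1 => if h : k < q then P.perm (idx ⟨k, h⟩) * partialProd P idx k
      else partialProd P idx k

end PMR

/-! ### Thermal averages and the energy susceptibility -/

section
variable {ι : Type*} [Fintype ι] [DecidableEq ι]

/-- The thermal average `Tr[O e^{-βH}] / Tr[e^{-βH}]`. -/
noncomputable def thermalAverage (H : Matrix ι ι ℂ) (β : ℝ) (O : Matrix ι ι ℂ) : ℂ :=
  (O * NormedSpace.exp (-(β : ℂ) • H)).trace / (NormedSpace.exp (-(β : ℂ) • H)).trace

/-- The imaginary-time evolved operator `O(τ) = e^{τH} O e^{-τH}`. -/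
noncomputable def imagTimeEvolve (H : Matrix ι ι ℂ) (τ : ℝ) (O : Matrix ι ι ℂ) : Matrix ι ι ℂ :=
  NormedSpace.exp ((τ : ℂ) • H) * O * NormedSpace.exp (-(τ : ℂ) • H)

/-- The integrated correlator `∫₀^β ⟨O(τ) O⟩ dτ`. -/
noncomputable def integratedCorrelator (H : Matrix ι ι ℂ) (β : ℝ) (O : Matrix ι ι ℂ) : ℂ :=
  ∫ τ in (0 : ℝ)..β, thermalAverage H β (imagTimeEvolve H τ O * O)

/-- The energy susceptibility at inverse temperature `β` of the Hamiltonian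
`H(lam) = H₀ + lam H₁` with respect to its driving term `H₁`. -/
noncomputable def energySusceptibility (H₀ H₁ : Matrix ι ι ℂ) (lam β : ℝ) : ℂ :=
  ∫ τ in (0 : ℝ)..β,
    (thermalAverage (H₀ + (lam : ℂ) • H₁) β (imagTimeEvolve (H₀ + (lam : ℂ) • H₁) τ H₁ * H₁)
      - thermalAverage (H₀ + (lam : ℂ) • H₁) β H₁ ^ 2)

end

/-! ### Divided differences of the exponential -/

/-- The divided difference `f[x 0, …, x (n-1)]` of an entire function `f`, as the contour
integral `(2πi)⁻¹ ∮ f(z) / ∏ i, (z - x i) dz` over a circle that encloses all the nodes. -/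
noncomputable def dividedDifference (f : ℂ → ℂ) {n : ℕ} (x : Fin n → ℂ) : ℂ :=
  (2 * Real.pi * Complex.I)⁻¹ *
    ∮ z in C(0, 1 + ∑ i, ‖x i‖), f z / ∏ i, (z - x i)

/-- The divided difference of the exponential, `e^{t[x 0, …, x (n-1)]}`. -/
noncomputable def expDividedDifference (t : ℂ) {n : ℕ} (x : Fin n → ℂ) : ℂ :=
  dividedDifference (fun z => Complex.exp (t * z)) x

/-! ### Configurations, weights and estimators -/

/-- A configuration: a basis state `z` and a sequence of `q` permutations `P_{i_1}, …, P_{i_q}`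
whose product is the identity. -/
structure Config {ι : Type*} {M : ℕ} (P : PMR ι M) where
  z : ι
  q : ℕ
  idx : Fin q → Fin M
  closed : P.partialProd idx q = 1

namespace Config
variable {ι : Type*} {M : ℕ} {P : PMR ι M}

/-- The basis state `z_k` reached after the first `k` permutations. -/
def state (C : Config P) (k : ℕ) : ι := P.partialProd C.idx k C.z

/-- The diagonal energy `E_{z_k}`. -/
def energy (C : Config P) (k : ℕ) : ℂ := P.diag0 (C.state k)

/-- The off-diagonal hopping term `∏ₖ ⟨z_k| D_{i_k} |z_k⟩`, with `k` from `1` to `q`. -/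
def hopping (C : Config P) : ℂ := ∏ k : Fin C.q, P.diag (C.idx k) (C.state (k + 1))

/-- The divided difference `e^{-β[E_{z_0}, …, E_{z_k}]}`. -/
noncomputable def dde (C : Config P) (β : ℝ) (k : ℕ) : ℂ :=
  expDividedDifference (-(β : ℂ)) (fun i : Fin (k + 1) => C.energy i)

/-- The weight `w_C` of a configuration. -/
noncomputable def weight (C : Config P) (β : ℝ) : ℂ := C.hopping * C.dde β C.q

/-- `1_{q ≥ 1} e^{-β[E_{z_0}, …, E_{z_{q-1}}]} / e^{-β[E_{z_0}, …, E_{z_q}]}`. -/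
noncomputable def ratio1 (C : Config P) (β : ℝ) : ℂ :=
  if 1 ≤ C.q then C.dde β (C.q - 1) / C.dde β C.q else 0

/-- `1_{q ≥ 2} e^{-β[E_{z_0}, …, E_{z_{q-2}}]} / e^{-β[E_{z_0}, …, E_{z_q}]}`. -/
noncomputable def ratio2 (C : Config P) (β : ℝ) : ℂ :=
  if 2 ≤ C.q then C.dde β (C.q - 2) / C.dde β C.q else 0

/-- The configuration function
`β E_{z_0}² + q E_{z_0} + 1_{q>0} β E_{z_0} e^{-β[E_{z_0}, …, E_{z_{q-1}}]} / e^{-β[E_{z_0}, …, E_{z_q}]}`. -/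
noncomputable def diagEstimator (C : Config P) (β : ℝ) : ℂ :=
  β * C.energy 0 ^ 2 + C.q * C.energy 0
    + if 0 < C.q then β * C.energy 0 * (C.dde β (C.q - 1) / C.dde β C.q) else 0

/-- The configuration function for `⟨H²⟩`. -/
noncomputable def energySqEstimator (C : Config P) (β : ℝ) : ℂ :=
  C.energy C.q ^ 2 + (C.energy C.q + C.energy (C.q - 1)) * C.ratio1 β + C.ratio2 β

/-- The configuration function for `⟨D₀ H⟩`. -/
noncomputable def diagEnergyEstimator (C : Config P) (β : ℝ) : ℂ :=
  C.energy 0 * (C.energy 0 + C.ratio1 β)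

/-- The configuration function for `∫₀^β ⟨Γ(τ) Γ⟩ dτ`, where `Γ = H - D₀`. -/
noncomputable def offDiagEstimator (C : Config P) (β : ℝ) : ℂ :=
  β * C.energySqEstimator β + C.diagEstimator β - 2 * β * C.diagEnergyEstimator β

end Config

section
variable {ι : Type*} {M : ℕ}

/-- The weighted average `∑ w_C F_C / ∑ w_C` over all configurations. -/
noncomputable def configAverage (P : PMR ι M) (β : ℝ) (F : Config P → ℂ) : ℂ :=
  (∑' C : Config P, C.weight β * F C) / ∑' C : Config P, C.weight β

/-- `F` is an (exact) estimator of the value `v`: both series converge absolutely, the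
normalization does not vanish, and the weighted average of `F` is `v`. -/
def Estimates (P : PMR ι M) (β : ℝ) (F : Config P → ℂ) (v : ℂ) : Prop :=
  Summable (fun C : Config P => C.weight β) ∧
  Summable (fun C : Config P => C.weight β * F C) ∧
  (∑' C : Config P, C.weight β) ≠ 0 ∧
  v = configAverage P β F

end

/-! ### Cost of evaluating an estimator

A register machine with integer registers (for counting and addressing) and scalar registers
(with exact arithmetic), conditional jumps and random access to a read-only input, in which every
instruction costs one unit of time. The input
holds what a simulation keeps up to date for the current configuration: the order `q`, the
parameters, the diagonal energies `E_{z_0}, …, E_{z_q}`, and the divided differences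
`e^{-β[E_{z_0}, …, E_{z_k}]}` for `k ≤ q`. Any other divided difference has to be computed. -/

/-- The read-only input of the machine; `energy k` and `dde k` exist only for `k ≤ q`. -/
structure InputMemory where
  q : ℕ
  β : ℂ
  coupling : ℂ
  energy : ℕ → ℂ
  dde : ℕ → ℂ

/-- Instructions. The first argument `r` is the target register, the others are source registers,
except for the constant of `natConst` and the target address `l` of a jump. -/
inductive Instr where
  | natConst (r n : ℕ)
  | natAdd (r a b : ℕ)
  | natSub (r a b : ℕ)
  | loadOrder (r : ℕ)
  | ofNat (r a : ℕ)
  | loadBeta (r : ℕ)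
  | loadCoupling (r : ℕ)
  | loadEnergy (r a : ℕ)
  | loadDDE (r a : ℕ)
  | add (r a b : ℕ)
  | sub (r a b : ℕ)
  | mul (r a b : ℕ)
  | div (r a b : ℕ)
  | jump (l : ℕ)
  | jumpZero (a l : ℕ)
  | halt

/-- A state: program counter, integer registers, scalar registers. -/
structure MachineState where
  pc : ℕ
  nat : ℕ → ℕ
  scal : ℕ → ℂ

namespace MachineState

/-- The initial state. -/
def init : MachineState := ⟨0, fun _ => 0, fun _ => 0⟩

/-- Write an integer register and go to the next instruction. -/
def setNat (s : MachineState) (r n : ℕ) : MachineState :=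
  ⟨s.pc + 1, Function.update s.nat r n, s.scal⟩

/-- Write a scalar register and go to the next instruction. -/
noncomputable def setScal (s : MachineState) (r : ℕ) (x : ℂ) : MachineState :=
  ⟨s.pc + 1, s.nat, Function.update s.scal r x⟩

/-- Go to a given instruction. -/
def goTo (s : MachineState) (l : ℕ) : MachineState := ⟨l, s.nat, s.scal⟩

end MachineState

open Classical in
/-- The effect of one instruction; `none` is a failure (an access to an input cell that does not
exist, a division by zero) or the stop at `halt`. -/
noncomputable def Instr.exec (m : InputMemory) (s : MachineState) : Instr → Option MachineState
  | natConst r n => some (s.setNat r n)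
  | natAdd r a b => some (s.setNat r (s.nat a + s.nat b))
  | natSub r a b => some (s.setNat r (s.nat a - s.nat b))
  | loadOrder r => some (s.setNat r m.q)
  | ofNat r a => some (s.setScal r (s.nat a))
  | loadBeta r => some (s.setScal r m.β)
  | loadCoupling r => some (s.setScal r m.coupling)
  | loadEnergy r a => if s.nat a ≤ m.q then some (s.setScal r (m.energy (s.nat a))) else none
  | loadDDE r a => if s.nat a ≤ m.q then some (s.setScal r (m.dde (s.nat a))) else none
  | add r a b => some (s.setScal r (s.scal a + s.scal b))
  | sub r a b => some (s.setScal r (s.scal a - s.scal b))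
  | mul r a b => some (s.setScal r (s.scal a * s.scal b))
  | div r a b => if s.scal b = 0 then none else some (s.setScal r (s.scal a / s.scal b))
  | jump l => some (s.goTo l)
  | jumpZero a l => some (if s.nat a = 0 then s.goTo l else s.goTo (s.pc + 1))
  | halt => none

/-- One step of a program (a failure if the program counter is out of range). -/
noncomputable def machineStep (prog : List Instr) (m : InputMemory) (s : MachineState) :
    Option MachineState :=
  match prog[s.pc]? with
  | some i => i.exec m s
  | none => none

/-- The state after `n` steps from the initial state. -/
noncomputable def machineRun (prog : List Instr) (m : InputMemory) : ℕ → Option MachineState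
  | 0 => some MachineState.init
  | n + 1 => (machineRun prog m n).bind (machineStep prog m)

/-- The program reaches `halt` after at most `K` steps, with `out` in scalar register `0`. -/
def OutputsWithin (prog : List Instr) (m : InputMemory) (K : ℕ) (out : ℂ) : Prop :=
  ∃ n ≤ K, ∃ s, machineRun prog m n = some s ∧ prog[s.pc]? = some Instr.halt ∧ s.scal 0 = out

/-- The input of the machine for a given configuration. -/
noncomputable def Config.memory {ι : Type*} {M : ℕ} {P : PMR ι M} (C : Config P) (β c : ℝ) :
    InputMemory :=
  ⟨C.q, β, c, fun k => if k ≤ C.q then C.energy k else 0,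
    fun k => if k ≤ C.q then C.dde β k else 0⟩

/-- An estimator is computable in time `O(1)`: one program evaluates it within one fixed number of
steps, for all Hamiltonians (of all dimensions), all inverse temperatures `β`, all couplings `c`
and all configurations. -/
def ComputableInConstantTime
    (F : ∀ {ι : Type u} {M : ℕ} (P : PMR ι M), ℝ → ℝ → Config P → ℂ) : Prop :=
  ∃ (prog : List Instr) (K : ℕ),
    ∀ (ι : Type u) [Fintype ι] [DecidableEq ι] [Nonempty ι] (M : ℕ) (P : PMR ι M),
      P.matrix.IsHermitian → ∀ β : ℝ, 0 < β → ∀ (c : ℝ) (C : Config P),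
        OutputsWithin prog (C.memory β c) K (F P β c C)

/-! Expand `H ^ n` over words in `D₀` and the `D j * P j`. Collecting the words with the same
sequence of `q` off-diagonal letters leaves the hopping product times the complete homogeneous
polynomial of degree `n - q` in the energies `E_{z_0}, …, E_{z_q}`, which is the divided difference
of `z ^ n` at these nodes (`sum_pathMatrix`). Summing over `n` with `(-β) ^ n / n!` turns these
polynomials into divided differences of the exponential (`hasSum_expDividedDifference`). A trace
keeps the paths that return to their start, and simple transitivity makes their permutation product
the identity, so the trace is a sum over configurations.

With `s` extra factors of `H`, the trace of `diagonal φ * H ^ s * exp (-β H)` is obtained by using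
the divided difference of `x ^ s * exp (-β x)` (`hasSum_trace_of_pow`). The Leibniz rule writes it
through `e^{-β[…]}` with fewer nodes, which is where `R_1` and `R_2` come from.

For the correlator, Duhamel's formula expresses the integral by the words in which one factor `H`
has been replaced by `D₀`. A word of length `n` with `q` off-diagonal letters has `n - q` diagonal
ones, hence it occurs `n - q` times (`sum_smul_pathMatrix`). In the exponential series the factor
`n` yields the divided difference of `-β x * exp (-β x)`, and the factor `-q` yields the term `q
E_{z_0}` of the estimator (`hasSum_sub_mul_dde`). The off-diagonal driving term reduces to this case
because `H` commutes with its own evolution (`integratedCorrelator_sub`).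

Two analytic points remain. The sums over `n` and over configurations may be exchanged because the
path sums grow only geometrically in `n` (`exists_norm_bound`, `HasSum.swap_exp_series`). The
denominators do not vanish because a shift of the real nodes makes every term of the series
nonnegative (`expDividedDifference_ne_zero`). Constant time is possible because every quantity
needed is an input cell or differs from one by a bounded number of operations. -/

/-! ### Divided differences of powers -/

/-- The divided difference of `z ↦ z ^ n` at the nodes `x 0, …, x k`, that is, the complete
homogeneous symmetric polynomial of degree `n - k` in the nodes, and `0` if `n < k`. -/
def powDividedDifference {R : Type*} [Semiring R] (x : ℕ → R) : ℕ → ℕ → R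
  | 0, 0 => 1
  | 0, _ + 1 => 0
  | n + 1, 0 => x 0 * powDividedDifference x n 0
  | n + 1, k + 1 => x (k + 1) * powDividedDifference x n (k + 1) + powDividedDifference x n k

section PowDividedDifference

variable {R : Type*} [Semiring R]

theorem powDividedDifference_congr {x y : ℕ → R} {k : ℕ} (h : ∀ i ≤ k, x i = y i) (n : ℕ) :
    powDividedDifference x n k = powDividedDifference y n k := by
  induction n generalizing k with
  | zero => cases k <;> simp [powDividedDifference]
  | succ n ih =>
    cases k with
    | zero => simp [powDividedDifference, h 0 le_rfl, ih h]
    | succ k =>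
      simp only [powDividedDifference]
      rw [h _ le_rfl, ih h, ih fun i hi => h i (by omega)]

theorem powDividedDifference_eq_zero (x : ℕ → R) {n k : ℕ} (h : n < k) :
    powDividedDifference x n k = 0 := by
  induction n generalizing k with
  | zero => obtain ⟨k, rfl⟩ := Nat.exists_eq_succ_of_ne_zero h.ne'; rfl
  | succ n ih =>
    obtain ⟨k, rfl⟩ := Nat.exists_eq_succ_of_ne_zero (by omega : k ≠ 0)
    simp [powDividedDifference, ih (show n < k by omega), ih (show n < k + 1 by omega)]

theorem powDividedDifference_self (x : ℕ → R) (k : ℕ) : powDividedDifference x k k = 1 := by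
  induction k with
  | zero => rfl
  | succ k ih => simp [powDividedDifference, ih, powDividedDifference_eq_zero]

/-- Homogeneity of degree `n - k`, with `t ^ k` moved to the other side so that no truncated
subtraction appears. -/
theorem powDividedDifference_smul {R : Type*} [CommRing R] (t : R) (x : ℕ → R) (n k : ℕ) :
    t ^ n * powDividedDifference x n k =
      t ^ k * powDividedDifference (fun i => t * x i) n k := by
  induction n generalizing k with
  | zero => cases k <;> simp [powDividedDifference]
  | succ n ih =>
    cases k with
    | zero =>
      simp only [powDividedDifference]
      linear_combination (t * x 0) * ih 0
    | succ k =>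
      simp only [powDividedDifference]
      linear_combination (t * x (k + 1)) * ih (k + 1) + t * ih k

theorem powDividedDifference_nonneg {x : ℕ → ℝ} (h : ∀ i, 0 ≤ x i) (n k : ℕ) :
    0 ≤ powDividedDifference x n k := by
  induction n generalizing k with
  | zero => cases k <;> simp [powDividedDifference]
  | succ n ih =>
    cases k with
    | zero => exact mul_nonneg (h 0) (ih 0)
    | succ k => exact add_nonneg (mul_nonneg (h _) (ih _)) (ih _)

theorem norm_powDividedDifference_le {x : ℕ → ℂ} {X : ℝ} (h : ∀ i, ‖x i‖ ≤ X) (n k : ℕ) :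
    ‖powDividedDifference x n k‖ ≤ powDividedDifference (fun _ => X) n k := by
  have hX : ∀ _ : ℕ, 0 ≤ X := fun _ => (norm_nonneg _).trans (h 0)
  induction n generalizing k with
  | zero => cases k <;> simp [powDividedDifference]
  | succ n ih =>
    cases k with
    | zero =>
      simp only [powDividedDifference, norm_mul]
      exact mul_le_mul (h 0) (ih 0) (norm_nonneg _) (hX 0)
    | succ k =>
      simp only [powDividedDifference]
      refine (norm_add_le _ _).trans (add_le_add ?_ (ih k))
      rw [norm_mul]
      exact mul_le_mul (h _) (ih _) (norm_nonneg _) (hX 0)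

/-- At equal nodes the divided difference is `n.choose k * X ^ (n - k)`, so this is the binomial
theorem, here as an inequality proved by Pascal's recursion. It provides the geometric growth rate
in `exists_norm_bound`. -/
theorem sum_pow_mul_powDividedDifference_const_le {X Y : ℝ} (hX : 0 ≤ X) (hY : 0 ≤ Y) (n N : ℕ) :
    ∑ k ∈ Finset.range N, Y ^ k * powDividedDifference (fun _ => X) n k ≤ (X + Y) ^ n := by
  have hc := powDividedDifference_nonneg (x := fun _ => X) (fun _ => hX)
  suffices h : ∀ N, ∑ k ∈ Finset.range (N + 1), Y ^ k * powDividedDifference (fun _ => X) n k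
      ≤ (X + Y) ^ n from
    (Finset.sum_le_sum_of_subset_of_nonneg (Finset.range_mono (Nat.le_succ N))
      fun k _ _ => mul_nonneg (pow_nonneg hY k) (hc n k)).trans (h N)
  induction n with
  | zero =>
    intro N
    rw [Finset.sum_range_succ']
    simp [powDividedDifference]
  | succ n ih =>
    intro N
    have hN := ih N
    rw [Finset.sum_range_succ'] at hN ⊢
    have h2 : ∑ k ∈ Finset.range N, Y ^ k * powDividedDifference (fun _ => X) n k
        ≤ (X + Y) ^ n := (Finset.sum_le_sum_of_subset_of_nonneg (Finset.range_mono (Nat.le_succ N))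
      fun k _ _ => mul_nonneg (pow_nonneg hY k) (hc n k)).trans (ih N)
    have : ∑ k ∈ Finset.range N, Y ^ (k + 1) * powDividedDifference (fun _ => X) (n + 1) (k + 1)
        = X * ∑ k ∈ Finset.range N, Y ^ (k + 1) * powDividedDifference (fun _ => X) n (k + 1)
          + Y * ∑ k ∈ Finset.range N, Y ^ k * powDividedDifference (fun _ => X) n k := by
      rw [Finset.mul_sum, Finset.mul_sum, ← Finset.sum_add_distrib]
      refine Finset.sum_congr rfl fun k _ => ?_
      simp only [powDividedDifference]
      ring
    rw [this, pow_succ' (X + Y)]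
    simp only [powDividedDifference, pow_zero, one_mul] at hN ⊢
    nlinarith [mul_le_mul_of_nonneg_left hN hX, mul_le_mul_of_nonneg_left h2 hY]

end PowDividedDifference

/-! ### The contour integral -/

section Contour

open Complex Finset

/-- The circle can be enlarged without changing the integral, and with at least two factors the
integrand decays like `S⁻²` while the length grows like `S`. -/
theorem circleIntegral_inv_prod_eq_zero (x : ℕ → ℂ) (k : ℕ) {R : ℝ} (hR : 0 < R)
    (hx : ∀ i, i ≤ k + 1 → ‖x i‖ < R) :
    ∮ z in C(0, R), (∏ i ∈ range (k + 2), (z - x i))⁻¹ = 0 := by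
  have hne : ∀ z : ℂ, R ≤ ‖z‖ → ∏ i ∈ range (k + 2), (z - x i) ≠ 0 := by
    intro z hz
    refine prod_ne_zero_iff.2 fun i hi => sub_ne_zero.2 ?_
    rintro rfl
    exact absurd (hx i (by simpa [Nat.lt_succ_iff] using hi)) (not_lt.2 hz)
  have hconst : ∀ S, R ≤ S → ∮ z in C(0, R), (∏ i ∈ range (k + 2), (z - x i))⁻¹
      = ∮ z in C(0, S), (∏ i ∈ range (k + 2), (z - x i))⁻¹ := by
    intro S hS
    symm
    refine circleIntegral_eq_of_differentiable_on_annulus_off_countable hR hS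
      Set.countable_empty (fun z hz => ContinuousAt.continuousWithinAt ?_) fun z hz => ?_
    · refine ContinuousAt.inv₀ (by fun_prop) (hne z ?_)
      simpa using hz.2
    · refine DifferentiableAt.inv (by fun_prop) (hne z ?_)
      have := hz.1.2
      simp only [Metric.mem_closedBall, dist_zero_right, not_le] at this
      exact this.le
  have hbound : ∀ S, 2 * R + 2 ≤ S →
      ‖∮ z in C(0, R), (∏ i ∈ range (k + 2), (z - x i))⁻¹‖ ≤ 8 * Real.pi * S⁻¹ := by
    intro S hS
    have hS0 : 0 < S := by linarith
    rw [hconst S (by linarith)]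
    -- Since `S ≥ 2R + 2`, every factor satisfies `‖z - x i‖ ≥ S / 2`, and `2 / S ≤ 1` allows
    -- discarding all but two factors.
    refine (circleIntegral.norm_integral_le_of_norm_le_const (C := (2 / S) ^ 2) hS0.le
      fun z hz => ?_).trans (le_of_eq ?_)
    · rw [norm_inv, norm_prod, ← prod_inv_distrib]
      have h2S : 2 / S ≤ 1 := by rw [div_le_one hS0]; linarith
      calc ∏ i ∈ range (k + 2), ‖z - x i‖⁻¹ ≤ ∏ _i ∈ range (k + 2), (2 / S) := by
            refine prod_le_prod (fun _ _ => by positivity) fun i hi => ?_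
            have h1 : ‖x i‖ < R := hx i (by simpa [Nat.lt_succ_iff] using hi)
            have h2 : ‖z‖ = S := by simpa using hz
            have h3 := norm_sub_norm_le z (x i)
            rw [inv_le_comm₀ (by linarith) (by positivity), inv_div]
            linarith
        _ = (2 / S) ^ (k + 2) := by rw [prod_const, card_range]
        _ ≤ (2 / S) ^ 2 := pow_le_pow_of_le_one (by positivity) h2S (by omega)
    · field_simp
      ring
  have hlim : Filter.Tendsto (fun S : ℝ => 8 * Real.pi * S⁻¹) Filter.atTop (nhds 0) := by
    simpa using tendsto_inv_atTop_zero.const_mul (8 * Real.pi)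
  exact norm_le_zero_iff.1 (ge_of_tendsto hlim (Filter.eventually_atTop.2 ⟨_, hbound⟩))

/-- Writing one factor `z` as `x k + (z - x k)` splits the integrand and reproduces the recursion of
`powDividedDifference`. -/
theorem circleIntegral_pow_div_prod (x : ℕ → ℂ) (n k : ℕ) {R : ℝ} (hR : 0 < R)
    (hx : ∀ i, i ≤ k → ‖x i‖ < R) :
    ∮ z in C(0, R), z ^ n / ∏ i ∈ range (k + 1), (z - x i) =
      2 * Real.pi * I * powDividedDifference x n k := by
  have hne : ∀ k, (∀ i, i ≤ k → ‖x i‖ < R) → ∀ i ≤ k, ∀ z ∈ Metric.sphere (0 : ℂ) R,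
      z - x i ≠ 0 := by
    intro k hk i hi z hz
    refine sub_ne_zero.2 ?_
    rintro rfl
    have : ‖x i‖ = R := by simpa using hz
    exact absurd (hk i hi) this.not_lt
  have hint : ∀ n k, (∀ i, i ≤ k → ‖x i‖ < R) →
      CircleIntegrable (fun z => z ^ n / ∏ i ∈ range (k + 1), (z - x i)) 0 R := by
    intro n k hk
    refine ContinuousOn.circleIntegrable hR.le ?_
    refine ContinuousOn.div (by fun_prop) (by fun_prop) fun z hz => ?_
    exact prod_ne_zero_iff.2 fun i hi => hne k hk i (by simpa [Nat.lt_succ_iff] using hi) z hz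
  induction n generalizing k with
  | zero =>
    cases k with
    | zero =>
      simpa [powDividedDifference] using circleIntegral.integral_sub_inv_of_mem_ball
        (c := 0) (w := x 0) (R := R) (by simpa using hx 0 le_rfl)
    | succ k => simpa [powDividedDifference] using circleIntegral_inv_prod_eq_zero x k hR hx
  | succ n ih =>
    cases k with
    | zero =>
      have h1 : ∮ z in C(0, R), z ^ (n + 1) / ∏ i ∈ range 1, (z - x i)
          = ∮ z in C(0, R), (x 0 * (z ^ n / ∏ i ∈ range 1, (z - x i)) + z ^ n) := by
        refine circleIntegral.integral_congr hR.le fun z hz => ?_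
        have := hne 0 hx 0 le_rfl z hz
        simp only [range_one, prod_singleton]
        field_simp
        ring
      have h0 : ∮ z in C(0, R), z ^ n = 0 :=
        circleIntegral_eq_zero_of_differentiable_on_off_countable hR.le Set.countable_empty
          (by fun_prop) fun z _ => by fun_prop
      rw [h1, circleIntegral.integral_add
        (f := fun z => x 0 * (z ^ n / ∏ i ∈ range 1, (z - x i))) (g := fun z => z ^ n)
        ((hint n 0 hx).const_smul (a := x 0)) (ContinuousOn.circleIntegrable hR.le (by fun_prop)), h0,
        circleIntegral.integral_const_mul, ih 0 hx]
      simp only [powDividedDifference]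
      ring
    | succ k =>
      have hk : ∀ i, i ≤ k → ‖x i‖ < R := fun i hi => hx i (by omega)
      have h1 : ∮ z in C(0, R), z ^ (n + 1) / ∏ i ∈ range (k + 1 + 1), (z - x i)
          = ∮ z in C(0, R), (x (k + 1) * (z ^ n / ∏ i ∈ range (k + 1 + 1), (z - x i))
            + z ^ n / ∏ i ∈ range (k + 1), (z - x i)) := by
        refine circleIntegral.integral_congr hR.le fun z hz => ?_
        have h2 := hne (k + 1) hx (k + 1) le_rfl z hz
        have h3 : ∏ i ∈ range (k + 1), (z - x i) ≠ 0 :=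
          prod_ne_zero_iff.2 fun i hi => hne k hk i (by simpa [Nat.lt_succ_iff] using hi) z hz
        simp only [prod_range_succ _ (k + 1)]
        field_simp
        ring
      rw [h1, circleIntegral.integral_add
        (f := fun z => x (k + 1) * (z ^ n / ∏ i ∈ range (k + 1 + 1), (z - x i)))
        (g := fun z => z ^ n / ∏ i ∈ range (k + 1), (z - x i))
        ((hint n (k + 1) hx).const_smul (a := x (k + 1))) (hint n k hk), circleIntegral.integral_const_mul, ih (k + 1) hx, ih k hk]
      simp only [powDividedDifference]
      ring

theorem hasSum_expDividedDifference (t : ℂ) (x : ℕ → ℂ) (k : ℕ) :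
    HasSum (fun n => t ^ n / n.factorial * powDividedDifference x n k)
      (expDividedDifference t (fun i : Fin (k + 1) => x i)) := by
  set R : ℝ := 1 + ∑ i : Fin (k + 1), ‖x i‖ with hRdef
  have hsum : 0 ≤ ∑ i : Fin (k + 1), ‖x i‖ := sum_nonneg fun _ _ => norm_nonneg _
  have hR : 0 < R := by linarith
  have hx1 : ∀ i : Fin (k + 1), ‖x i‖ + 1 ≤ R := by
    intro i
    have := single_le_sum (f := fun i : Fin (k + 1) => ‖x i‖) (fun _ _ => norm_nonneg _)
      (mem_univ i)
    linarith
  have hx : ∀ i, i ≤ k → ‖x i‖ < R := fun i hi => by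
    have : ‖x i‖ + 1 ≤ R := hx1 ⟨i, by omega⟩
    linarith
  -- The summand `1` in the radius keeps the circle at distance at least `1` from every node; the
  -- denominator can then be dropped from the dominating series.
  have hden : ∀ z ∈ Metric.sphere (0 : ℂ) R, 1 ≤ ‖∏ i : Fin (k + 1), (z - x i)‖ := by
    intro z hz
    rw [norm_prod]
    refine one_le_prod fun i _ => ?_
    have h2 : ‖z‖ = R := by simpa using hz
    have h3 := norm_sub_norm_le z (x i)
    have h4 := hx1 i
    linarith
  have hmain : HasSum (fun n => ∮ z in C(0, R),
      (t ^ n / n.factorial) * (z ^ n / ∏ i : Fin (k + 1), (z - x i)))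
      (∮ z in C(0, R), exp (t * z) / ∏ i : Fin (k + 1), (z - x i)) := by
    simp only [circleIntegral]
    refine intervalIntegral.hasSum_integral_of_dominated_convergence
      (fun n _ => R * ((‖t‖ * R) ^ n / n.factorial)) (fun n => ?_) (fun n => ?_) ?_ ?_ ?_
    · refine Continuous.aestronglyMeasurable ?_
      simp only [deriv_circleMap, smul_eq_mul]
      refine Continuous.mul (by fun_prop) (continuous_const.mul ?_)
      refine Continuous.div (by fun_prop) (by fun_prop) fun θ h => ?_
      have := hden _ (circleMap_mem_sphere 0 hR.le θ)
      rw [h, norm_zero] at this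
      linarith
    · refine Filter.Eventually.of_forall fun θ _ => ?_
      have h1 := hden _ (circleMap_mem_sphere 0 hR.le θ)
      have h2 : ‖circleMap 0 R θ‖ = R := by simp [abs_of_pos hR]
      simp only [deriv_circleMap, smul_eq_mul, norm_mul, norm_div, norm_pow, h2, norm_I, mul_one,
        Complex.norm_natCast]
      refine mul_le_mul_of_nonneg_left ?_ hR.le
      rw [mul_pow, mul_div_right_comm]
      exact mul_le_mul_of_nonneg_left (div_le_self (pow_nonneg hR.le n) h1) (by positivity)
    · exact Filter.Eventually.of_forall fun θ _ =>
        (Real.summable_pow_div_factorial (‖t‖ * R)).mul_left R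
    · exact intervalIntegrable_const
    · refine Filter.Eventually.of_forall fun θ _ => ?_
      have h1 : HasSum (fun n : ℕ => (t * circleMap 0 R θ) ^ n / n.factorial)
          (exp (t * circleMap 0 R θ)) := by
        rw [Complex.exp_eq_exp_ℂ]
        exact NormedSpace.expSeries_div_hasSum_exp _
      have h2 := (h1.div_const (∏ i : Fin (k + 1), (circleMap 0 R θ - x i))).mul_left
        (deriv (circleMap 0 R) θ)
      simp only [smul_eq_mul]
      refine h2.congr_fun fun n => ?_
      rw [mul_pow]
      ring
  unfold expDividedDifference dividedDifference
  refine (hmain.mul_left (2 * Real.pi * I)⁻¹).congr_fun fun n => ?_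
  have h1 := circleIntegral_pow_div_prod x n k hR hx
  rw [circleIntegral.integral_const_mul]
  simp only [prod_range] at h1
  rw [h1]
  have : (2 * Real.pi * I : ℂ) ≠ 0 := by simp [Real.pi_ne_zero]
  field_simp

end Contour

/-! ### Matrix exponentials entry by entry -/

section MatrixExp

variable {m : Type*} [Fintype m] [DecidableEq m]

open scoped Matrix.Norms.Operator in
theorem Matrix.hasSum_exp_apply (A : Matrix m m ℂ) (t : ℂ) (i j : m) :
    HasSum (fun n : ℕ => t ^ n / n.factorial * (A ^ n) i j) (NormedSpace.exp (t • A) i j) := by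
  have h := NormedSpace.exp_series_hasSum_exp' (𝕂 := ℂ) (t • A)
  have h1 := (h.map (Matrix.entryAddMonoidHom ℂ i j) (by
    change Continuous fun M : Matrix m m ℂ => M i j
    fun_prop))
  refine h1.congr_fun fun n => ?_
  simp [smul_pow]
  ring

theorem Matrix.hasSum_trace_mul_exp (Φ A : Matrix m m ℂ) (t : ℂ) :
    HasSum (fun n : ℕ => t ^ n / n.factorial * (Φ * A ^ n).trace)
      (Φ * NormedSpace.exp (t • A)).trace := by
  simp only [Matrix.trace, Matrix.diag, Matrix.mul_apply, Finset.mul_sum]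
  refine hasSum_sum fun i _ => hasSum_sum fun j _ => ?_
  refine ((hasSum_exp_apply A t j i).mul_left (Φ i j)).congr_fun fun n => ?_
  ring

end MatrixExp

/-! ### Divided differences as matrix entries -/

/-- The lower bidiagonal matrix with diagonal `x 0, …, x k` and ones below the diagonal. -/
def lowerBidiagonal (x : ℕ → ℂ) (k : ℕ) : Matrix (Fin (k + 1)) (Fin (k + 1)) ℂ :=
  Matrix.of fun i j => (if i = j then x i else 0) + if (i : ℕ) = j + 1 then 1 else 0

/-- Left multiplication by the bidiagonal matrix acts on the first column exactly as the recursion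
of `powDividedDifference`. -/
theorem lowerBidiagonal_pow_apply (x : ℕ → ℂ) (k n : ℕ) (i : Fin (k + 1)) :
    (lowerBidiagonal x k ^ n) i 0 = powDividedDifference x n i := by
  induction n generalizing i with
  | zero =>
    rw [pow_zero, Matrix.one_apply]
    cases i using Fin.cases <;> simp [powDividedDifference, Fin.succ_ne_zero]
  | succ n ih =>
    rw [pow_succ', Matrix.mul_apply]
    simp only [ih]
    simp only [lowerBidiagonal, Matrix.of_apply, add_mul, Finset.sum_add_distrib, ite_mul,
      zero_mul, one_mul, Finset.sum_ite_eq, Finset.mem_univ, if_true]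
    cases i using Fin.cases with
    | zero => simp [powDividedDifference]
    | succ i =>
      rw [Finset.sum_eq_single i.castSucc]
      · simp [powDividedDifference]
      · intro j _ hj
        rw [if_neg]
        intro h
        exact hj (Fin.ext (by simpa using h.symm))
      · simp

/-- Both series are the lower left entry of the exponential of a bidiagonal matrix. Shifting the
nodes adds the scalar matrix `s`, which is central, so the exponential gains the factor `exp s`. -/
theorem hasSum_powDividedDifference_add_const (x : ℕ → ℂ) (s y : ℂ) (k : ℕ)
    (h : HasSum (fun n : ℕ => powDividedDifference x n k / n.factorial) y) :
    HasSum (fun n : ℕ => powDividedDifference (fun i => x i + s) n k / n.factorial)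
      (Complex.exp s * y) := by
  have key : ∀ x : ℕ → ℂ, HasSum (fun n : ℕ => powDividedDifference x n k / n.factorial)
      (NormedSpace.exp (lowerBidiagonal x k) (Fin.last k) 0) := by
    intro x
    have := Matrix.hasSum_exp_apply (lowerBidiagonal x k) 1 (Fin.last k) 0
    rw [one_smul] at this
    refine this.congr_fun fun n => ?_
    rw [lowerBidiagonal_pow_apply, one_pow, Fin.val_last]
    ring
  have hadd : lowerBidiagonal (fun i => x i + s) k =
      Matrix.diagonal (fun _ => s) + lowerBidiagonal x k := by
    ext i j
    by_cases hij : i = j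
    · simp [lowerBidiagonal, hij, add_comm]
    · simp [lowerBidiagonal, hij]
  have hcomm : Commute (Matrix.diagonal (fun _ => s)) (lowerBidiagonal x k) := by
    ext i j
    simp [mul_comm]
  have h1 := key fun i => x i + s
  rw [hadd, Matrix.exp_add_of_commute _ _ hcomm, Matrix.exp_diagonal, Matrix.diagonal_mul,
    ← (h.unique (key x)), Pi.coe_exp, ← Complex.exp_eq_exp_ℂ] at h1
  exact h1

theorem expDividedDifference_ne_zero {t : ℝ} (ht : t ≠ 0) (x : ℕ → ℝ) (k : ℕ) :
    expDividedDifference (t : ℂ) (fun i : Fin (k + 1) => (x i : ℂ)) ≠ 0 := by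
  -- A lower bound of all `t * x i` with `i ≤ k`, so that the shifted nodes are nonnegative. Nodes
  -- beyond `k` play no role and are set to `0`.
  set s : ℝ := -∑ i ∈ Finset.range (k + 1), |t * x i| with hs
  set v : ℕ → ℝ := fun i => if i ≤ k then t * x i - s else 0 with hv
  have hv0 : ∀ i, 0 ≤ v i := by
    intro i
    simp only [hv]
    split_ifs with hi
    · have h1 := Finset.single_le_sum (f := fun i => |t * x i|) (fun _ _ => abs_nonneg _)
        (Finset.mem_range.2 (Nat.lt_succ_of_le hi))
      have h2 := neg_abs_le (t * x i)
      have h3 : |t * x i| ≤ -s := by simpa [hs] using h1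
      linarith
    · exact le_rfl
  have hmap : ∀ (y : ℕ → ℝ) (n j : ℕ), powDividedDifference (fun i => (y i : ℂ)) n j =
      (powDividedDifference y n j : ℝ) := by
    intro y n
    induction n with
    | zero => intro j; cases j <;> simp [powDividedDifference]
    | succ n ih => intro j; cases j <;> simp [powDividedDifference, ih]
  have hsum : Summable fun n : ℕ => powDividedDifference v n k / n.factorial := by
    have h1 := hasSum_expDividedDifference 1 (fun i => (v i : ℂ)) k
    have h2 := (Complex.hasSum_re h1).summable
    refine h2.congr fun n => ?_
    rw [hmap]
    have : ((1 : ℂ) ^ n / n.factorial * (powDividedDifference v n k : ℝ)) =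
      ((powDividedDifference v n k / n.factorial : ℝ) : ℂ) := by
      push_cast
      ring
    rw [this, Complex.ofReal_re]
  have hpos : 0 < ∑' n : ℕ, powDividedDifference v n k / n.factorial := by
    -- The term `n = k` is `1 / k!`, hence strictly positive.
    refine hsum.tsum_pos (fun n => div_nonneg (powDividedDifference_nonneg hv0 n k)
      (Nat.cast_nonneg _)) k ?_
    rw [powDividedDifference_self]
    positivity
  have h1 : HasSum (fun n : ℕ => powDividedDifference (fun i => (v i : ℂ)) n k / n.factorial)
      ((∑' n : ℕ, powDividedDifference v n k / n.factorial : ℝ) : ℂ) := by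
    refine (Complex.hasSum_ofReal.2 hsum.hasSum).congr_fun fun n => ?_
    rw [hmap]
    push_cast
    rfl
  have h2 := (hasSum_powDividedDifference_add_const _ (s : ℂ) _ k h1).mul_left ((t : ℂ) ^ k)
  have h3 := hasSum_expDividedDifference (t : ℂ) (fun i => (x i : ℂ)) k
  have h4 : expDividedDifference (t : ℂ) (fun i : Fin (k + 1) => (x i : ℂ)) = _ :=
    h3.unique (h2.congr_fun fun n => ?_)
  · rw [h4]
    have : (t : ℂ) ≠ 0 := by exact_mod_cast ht
    have h5 : ((∑' n : ℕ, powDividedDifference v n k / n.factorial : ℝ) : ℂ) ≠ 0 := by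
      exact_mod_cast hpos.ne'
    exact mul_ne_zero (pow_ne_zero _ this) (mul_ne_zero (Complex.exp_ne_zero _) h5)
  · have h6 : powDividedDifference (fun i => (v i : ℂ) + s) n k =
        powDividedDifference (fun i => (t : ℂ) * x i) n k := by
      refine powDividedDifference_congr (fun i hi => ?_) n
      simp only [hv, if_pos hi]
      push_cast
      ring
    rw [h6]
    have := powDividedDifference_smul (t : ℂ) (fun i => (x i : ℂ)) n k
    rw [div_mul_eq_mul_div, this]
    ring

/-! ### Path expansion of the powers of the Hamiltonian -/

namespace PMR

section Path

variable {ι : Type*} {M : ℕ} (P : PMR ι M)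

theorem partialProd_snoc {q : ℕ} (idx : Fin q → Fin M) (j : Fin M) {k : ℕ} (hk : k ≤ q) :
    P.partialProd (Fin.snoc idx j : Fin (q + 1) → Fin M) k = P.partialProd idx k := by
  induction k with
  | zero => rfl
  | succ k ih =>
    have h1 : k < q := hk
    have h2 : k < q + 1 := by omega
    have h3 : (Fin.snoc idx j : Fin (q + 1) → Fin M) ⟨k, h2⟩ = idx ⟨k, h1⟩ :=
      Fin.snoc_castSucc (α := fun _ => Fin M) j idx ⟨k, h1⟩
    simp only [partialProd, dif_pos h1, dif_pos h2, ih h1.le, h3]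

theorem partialProd_snoc_last {q : ℕ} (idx : Fin q → Fin M) (j : Fin M) :
    P.partialProd (Fin.snoc idx j : Fin (q + 1) → Fin M) (q + 1) =
      P.perm j * P.partialProd idx q := by
  have h3 : (Fin.snoc idx j : Fin (q + 1) → Fin M) ⟨q, q.lt_succ_self⟩ = j :=
    Fin.snoc_last (α := fun _ => Fin M) j idx
  have h4 := P.partialProd_snoc idx j le_rfl
  simp only [partialProd, dif_pos q.lt_succ_self, h3, h4]

theorem partialProd_mem {q : ℕ} (idx : Fin q → Fin M) (k : ℕ) :
    P.partialProd idx k ∈ P.group := by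
  induction k with
  | zero => exact one_mem _
  | succ k ih =>
    simp only [partialProd]
    split_ifs
    · exact mul_mem (P.perm_mem _) ih
    · exact ih

-- The action is free by the uniqueness in simple transitivity. Hence a path that returns to its
-- starting state is a configuration, and no `P j` has a fixed point.
variable {P} in
theorem eq_one_of_apply_eq_self {g : Equiv.Perm ι} (hg : g ∈ P.group) {z : ι} (h : g z = z) :
    g = 1 := by
  have := (P.simply_transitive z z).unique (y₁ := ⟨g, hg⟩) (y₂ := 1) h (by simp)
  exact congrArg Subtype.val this

/-- The product of the off-diagonal matrix elements along a path. -/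
def pathHopping {q : ℕ} (idx : Fin q → Fin M) (z : ι) : ℂ :=
  ∏ k : Fin q, P.diag (idx k) (P.partialProd idx (k + 1) z)

/-- The diagonal energies along a path. -/
def pathEnergy {q : ℕ} (idx : Fin q → Fin M) (z : ι) (k : ℕ) : ℂ :=
  P.diag0 (P.partialProd idx k z)

theorem pathHopping_snoc {q : ℕ} (idx : Fin q → Fin M) (j : Fin M) (z : ι) :
    P.pathHopping (Fin.snoc idx j : Fin (q + 1) → Fin M) z =
      P.pathHopping idx z * P.diag j (P.perm j (P.partialProd idx q z)) := by
  rw [pathHopping, Fin.prod_univ_castSucc]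
  congr 1
  · refine Finset.prod_congr rfl fun k _ => ?_
    rw [Fin.snoc_castSucc (α := fun _ => Fin M), Fin.val_castSucc,
      partialProd_snoc P idx j (show (k : ℕ) + 1 ≤ q from k.2)]
  · rw [Fin.snoc_last (α := fun _ => Fin M), Fin.val_last, partialProd_snoc_last]
    rfl

variable [DecidableEq ι]

/-- The contribution of the paths with `q` off-diagonal steps to the `n`-th power of the
Hamiltonian. -/
def pathMatrix (n q : ℕ) : Matrix ι ι ℂ := Matrix.of fun z' z =>
  ∑ idx : Fin q → Fin M, if P.partialProd idx q z = z' then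
    P.pathHopping idx z * powDividedDifference (P.pathEnergy idx z) n q else 0

theorem pathMatrix_eq_zero {n q : ℕ} (h : n < q) : P.pathMatrix n q = 0 := by
  ext z' z
  simp [pathMatrix, powDividedDifference_eq_zero _ h]

theorem pathMatrix_zero_zero : P.pathMatrix 0 0 = 1 := by
  ext z' z
  simp [pathMatrix, pathHopping, powDividedDifference, partialProd, Matrix.one_apply, eq_comm]

variable [Fintype ι]

/-- The off-diagonal part of the Hamiltonian. -/
def offDiagPart : Matrix ι ι ℂ := ∑ j, Matrix.diagonal (P.diag j) * permOp (P.perm j)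

theorem matrix_eq_add : P.matrix = P.diagPart + P.offDiagPart := rfl

theorem pathMatrix_succ_zero (n : ℕ) :
    P.pathMatrix (n + 1) 0 = P.diagPart * P.pathMatrix n 0 := by
  ext z' z
  rw [diagPart, Matrix.diagonal_mul]
  simp only [pathMatrix, Matrix.of_apply, Finset.mul_sum]
  refine Finset.sum_congr rfl fun idx _ => ?_
  split_ifs with h
  · simp only [powDividedDifference, pathEnergy, h]
    ring
  · simp

theorem offDiagPart_mul_apply (A : Matrix ι ι ℂ) (z' z : ι) :
    (P.offDiagPart * A) z' z = ∑ j, P.diag j z' * A ((P.perm j)⁻¹ z') z := by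
  rw [offDiagPart, Finset.sum_mul, Matrix.sum_apply]
  refine Finset.sum_congr rfl fun j _ => ?_
  rw [Matrix.mul_assoc, Matrix.diagonal_mul, permOp, PEquiv.toMatrix_toPEquiv_mul,
    Matrix.submatrix_apply, id]

/-- The leftmost letter of a word is either diagonal, contributing the energy of the endpoint, or it
is the last off-diagonal step. The two cases are the two terms of the recursion of
`powDividedDifference`. -/
theorem pathMatrix_succ_succ (n q : ℕ) :
    P.pathMatrix (n + 1) (q + 1) =
      P.diagPart * P.pathMatrix n (q + 1) + P.offDiagPart * P.pathMatrix n q := by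
  ext z' z
  rw [Matrix.add_apply, offDiagPart_mul_apply, diagPart, Matrix.diagonal_mul]
  have h1 : ∀ m k, P.pathMatrix m k z' z = ∑ idx : Fin k → Fin M,
      if P.partialProd idx k z = z' then
        P.pathHopping idx z * powDividedDifference (P.pathEnergy idx z) m k else 0 :=
    fun _ _ => rfl
  have h2 : ∑ j, P.diag j z' * P.pathMatrix n q ((P.perm j)⁻¹ z') z =
      ∑ idx : Fin (q + 1) → Fin M, if P.partialProd idx (q + 1) z = z' then
        P.pathHopping idx z * powDividedDifference (P.pathEnergy idx z) n q else 0 := by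
    rw [← (Fin.snocEquiv fun _ : Fin (q + 1) => Fin M).sum_comp, Fintype.sum_prod_type]
    refine Finset.sum_congr rfl fun j _ => ?_
    simp only [pathMatrix, Matrix.of_apply, Finset.mul_sum]
    refine Finset.sum_congr rfl fun idx _ => ?_
    change _ = if P.partialProd (Fin.snoc idx j : Fin (q + 1) → Fin M) (q + 1) z = z' then
      P.pathHopping (Fin.snoc idx j : Fin (q + 1) → Fin M) z *
        powDividedDifference (P.pathEnergy (Fin.snoc idx j : Fin (q + 1) → Fin M) z) n q else 0
    -- Before the new step is taken, only the nodes `0, …, q` occur, and these do not depend on the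
    -- appended index.
    have h2 : powDividedDifference
        (P.pathEnergy (Fin.snoc idx j : Fin (q + 1) → Fin M) z) n q =
        powDividedDifference (P.pathEnergy idx z) n q :=
      powDividedDifference_congr (fun i hi => by
        rw [pathEnergy, pathEnergy, partialProd_snoc P idx j hi]) n
    rw [partialProd_snoc_last, pathHopping_snoc, Equiv.Perm.mul_apply, h2]
    by_cases h : P.perm j (P.partialProd idx q z) = z'
    · rw [if_pos h, if_pos (Equiv.Perm.eq_inv_iff_eq.2 h), h]
      ring
    · rw [if_neg h, if_neg, mul_zero]
      intro h'
      exact h (Equiv.Perm.eq_inv_iff_eq.1 h')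
  rw [h2, h1, h1, Finset.mul_sum, ← Finset.sum_add_distrib]
  refine Finset.sum_congr rfl fun idx _ => ?_
  split_ifs with h
  · simp only [powDividedDifference]
    rw [show P.pathEnergy idx z (q + 1) = P.diag0 z' by rw [pathEnergy, h]]
    ring
  · simp

theorem sum_pathMatrix {n N : ℕ} (h : n < N) :
    ∑ q ∈ Finset.range N, P.pathMatrix n q = P.matrix ^ n := by
  obtain ⟨N, rfl⟩ := Nat.exists_eq_succ_of_ne_zero (by omega : N ≠ 0)
  induction n generalizing N with
  | zero =>
    rw [Finset.sum_range_succ', pathMatrix_zero_zero, pow_zero, Finset.sum_eq_zero, zero_add]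
    exact fun q _ => P.pathMatrix_eq_zero q.succ_pos
  | succ n ih =>
    obtain ⟨N, rfl⟩ := Nat.exists_eq_succ_of_ne_zero (by omega : N ≠ 0)
    have h1 := ih (N + 1) (by omega)
    have h2 := ih N (by omega)
    rw [Finset.sum_range_succ'] at h1 ⊢
    simp only [pathMatrix_succ_succ, pathMatrix_succ_zero, Finset.sum_add_distrib,
      ← Finset.mul_sum]
    rw [h2, add_right_comm, ← mul_add, h1, ← add_mul, ← matrix_eq_add, pow_succ']

/-- The sum `∑ H ^ a * D₀ * H ^ b` over `a + b + 1 = n`, defined recursively. -/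
def insertedPow : ℕ → Matrix ι ι ℂ
  | 0 => 0
  | n + 1 => P.matrix * insertedPow n + P.diagPart * P.matrix ^ n

/-- The factor `n - q` counts the diagonal letters of a word, that is, the positions at which the
inserted `D₀` can be located. -/
theorem sum_smul_pathMatrix {n N : ℕ} (h : n < N) :
    ∑ q ∈ Finset.range N, ((n : ℂ) - q) • P.pathMatrix n q = P.insertedPow n := by
  obtain ⟨N, rfl⟩ := Nat.exists_eq_succ_of_ne_zero (by omega : N ≠ 0)
  induction n generalizing N with
  | zero =>
    rw [Finset.sum_range_succ', Finset.sum_eq_zero]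
    · simp [insertedPow]
    · intro q _
      rw [P.pathMatrix_eq_zero q.succ_pos, smul_zero]
  | succ n ih =>
    obtain ⟨N, rfl⟩ := Nat.exists_eq_succ_of_ne_zero (by omega : N ≠ 0)
    have h1 := ih (N + 1) (by omega)
    have h2 := ih N (by omega)
    have h3 := P.sum_pathMatrix (n := n) (N := N + 1 + 1) (by omega)
    -- Prepending a diagonal letter raises the count `n - q` by one, which creates the extra `H ^
    -- n`; prepending an off-diagonal letter leaves it unchanged (`h5`).
    have h4 : ∑ q ∈ Finset.range (N + 1 + 1), ((n + 1 : ℕ) - q : ℂ) • P.pathMatrix n q =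
        P.insertedPow n + P.matrix ^ n := by
      rw [← h1, ← h3, ← Finset.sum_add_distrib]
      refine Finset.sum_congr rfl fun q _ => ?_
      rw [← one_smul ℂ (P.pathMatrix n q), smul_smul, smul_smul, ← add_smul]
      congr 1
      push_cast
      ring
    rw [Finset.sum_range_succ'] at h4 ⊢
    simp only [pathMatrix_succ_succ, pathMatrix_succ_zero, smul_add, Finset.sum_add_distrib,
      ← Matrix.mul_smul, ← Finset.mul_sum]
    have h5 : ∑ q ∈ Finset.range (N + 1), ((n + 1 : ℕ) - (q + 1 : ℕ) : ℂ) • P.pathMatrix n q =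
        P.insertedPow n := by
      rw [← h2]
      refine Finset.sum_congr rfl fun q _ => ?_
      congr 1
      push_cast
      ring
    rw [h5, add_right_comm, ← mul_add, h4, insertedPow, matrix_eq_add]
    noncomm_ring

end Path

end PMR

/-! ### Sums over configurations -/

/-- The geometric bound against `1 / n!` makes the double family absolutely summable; Fubini does
the rest. -/
theorem HasSum.swap_exp_series {α : Type*} {κ : ℕ → α → ℂ} {b : ℕ → ℂ} {g : α → ℂ} {t B : ℂ}
    {K R : ℝ} (hsum : ∀ n, HasSum (κ n) (b n))
    (hnorm : ∀ n, ∃ S, HasSum (fun C => ‖κ n C‖) S ∧ S ≤ K * R ^ n)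
    (hg : ∀ C, HasSum (fun n : ℕ => t ^ n / n.factorial * κ n C) (g C))
    (hB : HasSum (fun n : ℕ => t ^ n / n.factorial * b n) B) : HasSum g B := by
  set F : ℕ × α → ℂ := fun p => t ^ p.1 / p.1.factorial * κ p.1 p.2 with hF
  choose S hS hSle using hnorm
  have hsummable : Summable F := by
    refine Summable.of_norm ?_
    refine (summable_prod_of_nonneg fun p => norm_nonneg _).2 ⟨fun n => ?_, ?_⟩
    · simp only [hF, norm_mul]
      exact (hS n).summable.mul_left _
    · have h1 : ∀ n, ∑' C, ‖F (n, C)‖ = ‖t ^ n / (n.factorial : ℂ)‖ * S n := by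
        intro n
        simp only [hF, norm_mul]
        exact ((hS n).mul_left _).tsum_eq
      simp only [h1]
      refine Summable.of_nonneg_of_le (fun n => mul_nonneg (norm_nonneg _)
        ((hS n).nonneg fun _ => norm_nonneg _)) (fun n => ?_)
        ((Real.summable_pow_div_factorial (‖t‖ * R)).mul_left K)
      refine (mul_le_mul_of_nonneg_left (hSle n) (norm_nonneg _)).trans (le_of_eq ?_)
      rw [norm_div, norm_pow, Complex.norm_natCast, mul_pow]
      ring
  have h1 := hsummable.hasSum.prod_fiberwise fun n => (hsum n).mul_left (t ^ n / n.factorial)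
  have h2 := ((Equiv.prodComm α ℕ).hasSum_iff.2 hsummable.hasSum).prod_fiberwise fun C => hg C
  rwa [h1.unique hB] at h2

namespace Config

variable {ι : Type*} {M : ℕ} {P : PMR ι M}

/-- Configurations sorted by their number of off-diagonal steps. -/
def equivSigma (P : PMR ι M) :
    Config P ≃ Σ q : ℕ, {p : ι × (Fin q → Fin M) // P.partialProd p.2 q = 1} where
  toFun C := ⟨C.q, (C.z, C.idx), C.closed⟩
  invFun p := ⟨p.2.1.1, p.1, p.2.1.2, p.2.2⟩
  left_inv _ := rfl
  right_inv _ := rfl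

variable [Fintype ι]

open Classical in
theorem hasSum_of_eq_zero {E : Type*} [AddCommMonoid E] [TopologicalSpace E]
    (F : ∀ q, ι → (Fin q → Fin M) → E) (N : ℕ)
    (hF : ∀ q z idx, N ≤ q → F q z idx = 0) :
    HasSum (fun C : Config P => F C.q C.z C.idx) (∑ q ∈ Finset.range N, ∑ z, ∑ idx,
      if P.partialProd idx q = 1 then F q z idx else 0) := by
  rw [← (equivSigma P).symm.hasSum_iff]
  have h1 : ∀ q, ∑ z, ∑ idx : Fin q → Fin M, (if P.partialProd idx q = 1 then F q z idx else 0) =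
      ∑ p : {p : ι × (Fin q → Fin M) // P.partialProd p.2 q = 1}, F q p.1.1 p.1.2 := by
    intro q
    rw [← Fintype.sum_prod_type', ← Finset.sum_filter]
    exact Finset.sum_subtype _ (by simp) _
  simp only [h1]
  rw [Finset.sum_sigma']
  refine hasSum_sum_of_ne_finset_zero fun p hp => ?_
  have hq : N ≤ p.1 := by simpa using hp
  exact hF p.1 _ _ hq

variable [DecidableEq ι]

theorem hasSum_pathMatrix (φ : ι → ℂ) (w : ℕ → ℂ) {n N : ℕ} (hN : n < N) :
    HasSum (fun C : Config P =>
        φ C.z * (C.hopping * (w C.q * powDividedDifference C.energy n C.q)))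
      (∑ q ∈ Finset.range N, w q * (Matrix.diagonal φ * P.pathMatrix n q).trace) := by
  classical
  have h := hasSum_of_eq_zero (P := P) (fun q z idx => φ z * (P.pathHopping idx z *
    (w q * powDividedDifference (P.pathEnergy idx z) n q))) N fun q z idx hq => by
      simp [powDividedDifference_eq_zero _ (hN.trans_le hq)]
  have h1 : ∀ q, w q * (Matrix.diagonal φ * P.pathMatrix n q).trace = ∑ z,
      ∑ idx : Fin q → Fin M, if P.partialProd idx q = 1 then φ z * (P.pathHopping idx z *
        (w q * powDividedDifference (P.pathEnergy idx z) n q)) else 0 := by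
    intro q
    simp only [Matrix.trace, Matrix.diag, Matrix.diagonal_mul, PMR.pathMatrix, Matrix.of_apply,
      Finset.mul_sum]
    refine Finset.sum_congr rfl fun z _ => Finset.sum_congr rfl fun idx _ => ?_
    -- The trace sees paths that return to `z`, configurations require the product to be the
    -- identity; freeness of the action identifies the two.
    have : P.partialProd idx q z = z ↔ P.partialProd idx q = 1 :=
      ⟨PMR.eq_one_of_apply_eq_self (P.partialProd_mem idx q), fun h => by simp [h]⟩
    simp only [this]
    split_ifs
    · ring
    · simp
  simp only [h1]
  convert h <;> rfl

-- There are at most `M ^ q` sequences of length `q`, each with hopping at most `D ^ q`, so the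
-- binomial bound with `Y = M * D` gives the rate `R = X + M * D`. The constants are independent of
-- `w` and `n`.
omit [DecidableEq ι] in
theorem exists_norm_bound (P : PMR ι M) (φ : ι → ℂ) : ∃ K R : ℝ, ∀ (w : ℕ → ℂ) (W : ℝ) (n : ℕ),
    (∀ q ≤ n, ‖w q‖ ≤ W) → ∃ S, HasSum (fun C : Config P =>
        ‖φ C.z * (C.hopping * (w C.q * powDividedDifference C.energy n C.q))‖) S ∧
      S ≤ K * W * R ^ n := by
  classical
  set X : ℝ := ∑ z, ‖P.diag0 z‖ with hX
  set D : ℝ := ∑ j, ∑ z, ‖P.diag j z‖ with hD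
  set Φ : ℝ := ∑ z, ‖φ z‖ with hΦ
  have hX0 : 0 ≤ X := Finset.sum_nonneg fun _ _ => norm_nonneg _
  have hD0 : 0 ≤ D := Finset.sum_nonneg fun _ _ => Finset.sum_nonneg fun _ _ => norm_nonneg _
  have hDle : ∀ j z, ‖P.diag j z‖ ≤ D := fun j z =>
    (Finset.single_le_sum (f := fun z => ‖P.diag j z‖) (fun _ _ => norm_nonneg _)
      (Finset.mem_univ z)).trans (Finset.single_le_sum (f := fun j => ∑ z, ‖P.diag j z‖)
      (fun _ _ => Finset.sum_nonneg fun _ _ => norm_nonneg _) (Finset.mem_univ j))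
  refine ⟨Φ, X + M * D, fun w W n hw => ⟨_, hasSum_of_eq_zero (P := P) (fun q z idx =>
    ‖φ z * (P.pathHopping idx z * (w q * powDividedDifference (P.pathEnergy idx z) n q))‖)
    (n + 1) ?_, ?_⟩⟩
  · intro q z idx hq
    simp [powDividedDifference_eq_zero _ (Nat.lt_of_succ_le hq)]
  have hW0 : 0 ≤ W := (norm_nonneg _).trans (hw 0 n.zero_le)
  have hΦ0 : 0 ≤ Φ := Finset.sum_nonneg fun _ _ => norm_nonneg _
  have hc := powDividedDifference_nonneg (x := fun _ => X) (fun _ => hX0)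
  calc _ ≤ ∑ q ∈ Finset.range (n + 1), ∑ z, ∑ _idx : Fin q → Fin M,
        ‖φ z‖ * (D ^ q * (W * powDividedDifference (fun _ => X) n q)) := by
        refine Finset.sum_le_sum fun q hq => Finset.sum_le_sum fun z _ =>
          Finset.sum_le_sum fun idx _ => ?_
        have hpos : 0 ≤ D ^ q * (W * powDividedDifference (fun _ => X) n q) :=
          mul_nonneg (pow_nonneg hD0 q) (mul_nonneg hW0 (hc n q))
        split_ifs
        · rw [norm_mul, norm_mul, norm_mul]
          refine mul_le_mul_of_nonneg_left ?_ (norm_nonneg _)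
          refine mul_le_mul ?_ ?_ (by positivity) (pow_nonneg hD0 q)
          · rw [PMR.pathHopping, norm_prod]
            refine (Finset.prod_le_prod (fun _ _ => norm_nonneg _) fun k _ =>
              hDle _ _).trans (by simp)
          · refine mul_le_mul (hw q (by simpa [Nat.lt_succ_iff] using hq)) ?_ (norm_nonneg _) hW0
            exact norm_powDividedDifference_le (fun i => Finset.single_le_sum
              (f := fun z => ‖P.diag0 z‖) (fun _ _ => norm_nonneg _) (Finset.mem_univ _)) n q
        · exact mul_nonneg (norm_nonneg _) hpos
    _ = Φ * W * ∑ q ∈ Finset.range (n + 1),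
          (M * D) ^ q * powDividedDifference (fun _ => X) n q := by
        rw [Finset.mul_sum]
        refine Finset.sum_congr rfl fun q _ => ?_
        simp only [Finset.sum_const, Finset.card_univ, Fintype.card_fun, Fintype.card_fin,
          nsmul_eq_mul, ← Finset.mul_sum, ← Finset.sum_mul]
        push_cast
        rw [mul_pow]
        ring
    _ ≤ Φ * W * (X + M * D) ^ n :=
        mul_le_mul_of_nonneg_left (sum_pow_mul_powDividedDifference_const_le hX0
          (by positivity) n (n + 1)) (mul_nonneg hΦ0 hW0)

/-- The common source of all traces: `w = 1` serves `H ^ s`, and `w n q = n - q` serves the inserted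
`D₀`. The bound `2 ^ n` covers both and only doubles the geometric rate. -/
theorem hasSum_of_series (φ : ι → ℂ) (s : ℕ) {w : ℕ → ℕ → ℂ}
    (hw : ∀ n q, q ≤ n + s → ‖w n q‖ ≤ 2 ^ n) {t B : ℂ} {g : Config P → ℂ}
    (hg : ∀ C : Config P, HasSum (fun n : ℕ => t ^ n / n.factorial *
      (w n C.q * powDividedDifference C.energy (n + s) C.q)) (g C))
    (hB : HasSum (fun n : ℕ => t ^ n / n.factorial * ∑ q ∈ Finset.range (n + s + 1),
      w n q * (Matrix.diagonal φ * P.pathMatrix (n + s) q).trace) B) :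
    HasSum (fun C => φ C.z * (C.hopping * g C)) B := by
  obtain ⟨K, R, hKR⟩ := exists_norm_bound P φ
  refine HasSum.swap_exp_series (t := t) (K := K * R ^ s) (R := 2 * R)
    (fun n => hasSum_pathMatrix φ (w n) (Nat.lt_succ_self (n + s))) (fun n => ?_) (fun C => ?_) hB
  · obtain ⟨S, hS, hle⟩ := hKR (w n) (2 ^ n) (n + s) (hw n)
    refine ⟨S, hS, hle.trans (le_of_eq ?_)⟩
    rw [mul_pow, pow_add]
    ring
  · refine (((hg C).mul_left C.hopping).mul_left (φ C.z)).congr_fun fun n => ?_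
    ring

/-- The divided difference of `x ↦ x * exp (-β * x)` over the energies of a configuration. -/
noncomputable def ddeDeriv (C : Config P) (β : ℝ) (k : ℕ) : ℂ :=
  C.energy k * C.dde β k + if 1 ≤ k then C.dde β (k - 1) else 0

/-- The divided difference of `x ↦ x ^ 2 * exp (-β * x)` over the energies of a configuration. -/
noncomputable def ddeDeriv2 (C : Config P) (β : ℝ) (k : ℕ) : ℂ :=
  C.energy k * C.ddeDeriv β k + if 1 ≤ k then C.ddeDeriv β (k - 1) else 0

omit [Fintype ι] [DecidableEq ι] in
theorem hasSum_dde (C : Config P) (β : ℝ) (k : ℕ) :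
    HasSum (fun n : ℕ => (-β : ℂ) ^ n / n.factorial * powDividedDifference C.energy n k)
      (C.dde β k) :=
  hasSum_expDividedDifference _ _ _

/-- Leibniz rule for the product with the identity function: `(x f)[x_0, …, x_k] = x_k f[x_0, …,
x_k] + f[x_0, …, x_{k-1}]`. -/
theorem _root_.hasSum_powDividedDifference_succ (x : ℕ → ℂ) (t : ℂ) (s : ℕ) {G : ℕ → ℂ}
    (h : ∀ k, HasSum (fun n : ℕ => t ^ n / n.factorial * powDividedDifference x (n + s) k) (G k))
    (k : ℕ) :
    HasSum (fun n : ℕ => t ^ n / n.factorial * powDividedDifference x (n + (s + 1)) k)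
      (x k * G k + if 1 ≤ k then G (k - 1) else 0) := by
  cases k with
  | zero =>
    simp only [Nat.one_ne_zero, nonpos_iff_eq_zero, if_false, add_zero]
    refine ((h 0).mul_left (x 0)).congr_fun fun n => ?_
    rw [← add_assoc, powDividedDifference]
    ring
  | succ k =>
    rw [if_pos (by omega), Nat.add_sub_cancel]
    refine (((h (k + 1)).mul_left (x (k + 1))).add (h k)).congr_fun fun n => ?_
    rw [← add_assoc, powDividedDifference]
    ring

omit [Fintype ι] [DecidableEq ι] in
theorem hasSum_ddeDeriv (C : Config P) (β : ℝ) (k : ℕ) :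
    HasSum (fun n : ℕ => (-β : ℂ) ^ n / n.factorial * powDividedDifference C.energy (n + 1) k)
      (C.ddeDeriv β k) :=
  hasSum_powDividedDifference_succ C.energy (-β) 0 (C.hasSum_dde β) k

omit [Fintype ι] [DecidableEq ι] in
theorem hasSum_ddeDeriv2 (C : Config P) (β : ℝ) (k : ℕ) :
    HasSum (fun n : ℕ => (-β : ℂ) ^ n / n.factorial * powDividedDifference C.energy (n + 2) k)
      (C.ddeDeriv2 β k) :=
  hasSum_powDividedDifference_succ C.energy (-β) 1 (C.hasSum_ddeDeriv β) k

-- The factor `n` cancels against `n!`; shifting the index by one leaves `-β` times the series of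
-- `ddeDeriv`.
omit [Fintype ι] [DecidableEq ι] in
theorem hasSum_sub_mul_dde (C : Config P) (β : ℝ) (k : ℕ) :
    HasSum (fun n : ℕ => (-β : ℂ) ^ n / n.factorial *
      (((n : ℂ) - k) * powDividedDifference C.energy n k))
      (-β * C.ddeDeriv β k - k * C.dde β k) := by
  have h1 : HasSum (fun n : ℕ => (-β : ℂ) ^ n / n.factorial *
      (n * powDividedDifference C.energy n k)) (-β * C.ddeDeriv β k) := by
    rw [← hasSum_nat_add_iff' 1]
    simp only [Finset.range_one, Finset.sum_singleton, Nat.cast_zero, zero_mul, mul_zero, sub_zero]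
    refine ((C.hasSum_ddeDeriv β k).mul_left (-β : ℂ)).congr_fun fun n => ?_
    have : (n.factorial : ℂ) ≠ 0 := by exact_mod_cast n.factorial_ne_zero
    have : (n + 1 : ℂ) ≠ 0 := by exact_mod_cast n.succ_ne_zero
    rw [Nat.factorial_succ, pow_succ]
    push_cast
    field_simp
  refine (h1.sub ((C.hasSum_dde β k).mul_left (k : ℂ))).congr_fun fun n => ?_
  ring

variable (P)

theorem hasSum_trace_of_pow (φ : ι → ℂ) (β : ℝ) (s : ℕ) {g : Config P → ℂ}
    (hg : ∀ C : Config P, HasSum (fun n : ℕ => (-β : ℂ) ^ n / n.factorial *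
      powDividedDifference C.energy (n + s) C.q) (g C)) :
    HasSum (fun C : Config P => φ C.z * (C.hopping * g C))
      (Matrix.diagonal φ * P.matrix ^ s * NormedSpace.exp (-(β : ℂ) • P.matrix)).trace := by
  refine hasSum_of_series φ s (w := fun _ _ => 1) (t := -(β : ℂ))
    (fun n q _ => by simpa using one_le_pow₀ (by norm_num : (1 : ℝ) ≤ 2))
    (fun C => by simpa only [one_mul] using hg C) ?_
  refine (Matrix.hasSum_trace_mul_exp _ P.matrix (-(β : ℂ))).congr_fun fun n => ?_
  simp only [one_mul]
  rw [← Matrix.trace_sum, ← Finset.mul_sum, P.sum_pathMatrix (Nat.lt_succ_self _), Matrix.mul_assoc,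
    ← pow_add, add_comm s n]

theorem hasSum_trace_insertedPow (φ : ι → ℂ) (β : ℝ) {B : ℂ}
    (hB : HasSum (fun n : ℕ => (-β : ℂ) ^ n / n.factorial *
      (Matrix.diagonal φ * P.insertedPow n).trace) B) :
    HasSum (fun C : Config P => φ C.z * (C.hopping *
      (-β * C.ddeDeriv β C.q - C.q * C.dde β C.q))) B := by
  refine hasSum_of_series φ 0 (w := fun n q => (n : ℂ) - q) (t := -(β : ℂ))
    (fun n q hq => ?_) (fun C => C.hasSum_sub_mul_dde β C.q) ?_
  · rw [add_zero] at hq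
    rw [← Nat.cast_sub hq, Complex.norm_natCast]
    exact_mod_cast (Nat.sub_le n q).trans n.lt_two_pow_self.le
  · refine hB.congr_fun fun n => ?_
    rw [← P.sum_smul_pathMatrix n.lt_succ_self, Matrix.mul_sum, Matrix.trace_sum]
    simp only [Matrix.mul_smul, Matrix.trace_smul, smul_eq_mul, add_zero]

end Config

/-! ### Duhamel's formula -/

section Duhamel

variable {ι : Type*} [Fintype ι] [DecidableEq ι]

open scoped Matrix.Norms.Operator in
theorem Matrix.hasDerivAt_exp_smul {m : Type*} [Fintype m] [DecidableEq m] (A : Matrix m m ℂ)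
    (τ : ℝ) : HasDerivAt (fun τ : ℝ => NormedSpace.exp ((τ : ℂ) • A))
      (NormedSpace.exp ((τ : ℂ) • A) * A) τ := by
  have h := (hasDerivAt_exp_smul_const A (τ : ℂ)).scomp τ Complex.ofRealCLM.hasDerivAt
  rw [Complex.ofRealCLM_apply, Complex.ofReal_one, one_smul] at h
  exact h

open scoped Matrix.Norms.Operator in
theorem Matrix.hasDerivAt_exp_neg_smul {m : Type*} [Fintype m] [DecidableEq m] (A : Matrix m m ℂ)
    (τ : ℝ) : HasDerivAt (fun τ : ℝ => NormedSpace.exp (-(τ : ℂ) • A))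
      (-(A * NormedSpace.exp (-(τ : ℂ) • A))) τ := by
  have h := (hasDerivAt_exp_smul_const' (-A) (τ : ℂ)).scomp τ Complex.ofRealCLM.hasDerivAt
  simp only [Complex.ofRealCLM_apply, Complex.ofReal_one, one_smul, Function.comp_def, smul_neg,
    neg_mul] at h
  simp only [neg_smul]
  exact h

open scoped Matrix.Norms.Operator in
theorem Matrix.continuous_exp_smul {m : Type*} [Fintype m] [DecidableEq m] (A : Matrix m m ℂ) :
    Continuous fun τ : ℝ => NormedSpace.exp ((τ : ℂ) • A) :=
  continuous_iff_continuousAt.2 fun τ => (Matrix.hasDerivAt_exp_smul A τ).continuousAt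

-- Differentiating `exp (τH)` puts `H` on its right and differentiating the block exponential puts
-- the block matrix on its left, so the two terms with `H` cancel and only the term with `D`
-- survives.
open scoped Matrix.Norms.Operator in
theorem Matrix.hasDerivAt_exp_mul_block (H D K : Matrix ι ι ℂ) (τ : ℝ) :
    HasDerivAt (fun τ : ℝ => (NormedSpace.exp ((τ : ℂ) • H) *
        (NormedSpace.exp (-(τ : ℂ) • Matrix.fromBlocks H D 0 H)).toBlocks₁₂ * K).trace)
      (-(NormedSpace.exp ((τ : ℂ) • H) * D *
        (NormedSpace.exp (-(τ : ℂ) • Matrix.fromBlocks H D 0 H)).toBlocks₂₂ * K).trace) τ := by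
  let L₁ : Matrix (ι ⊕ ι) (ι ⊕ ι) ℂ →ₗ[ℝ] Matrix ι ι ℂ :=
    { toFun := Matrix.toBlocks₁₂, map_add' := fun _ _ => rfl, map_smul' := fun _ _ => rfl }
  let L₂ : Matrix ι ι ℂ →ₗ[ℝ] ℂ :=
    { toFun := fun A => (A * K).trace
      map_add' := fun A B => by rw [add_mul, Matrix.trace_add]
      map_smul' := fun c A => by rw [Matrix.smul_mul, Matrix.trace_smul, RingHom.id_apply] }
  have h1 := Matrix.hasDerivAt_exp_smul H τ
  have h2 := (LinearMap.toContinuousLinearMap L₁).hasFDerivAt.comp_hasDerivAt τ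
    (Matrix.hasDerivAt_exp_neg_smul (Matrix.fromBlocks H D 0 H) τ)
  have h3 := (LinearMap.toContinuousLinearMap L₂).hasFDerivAt.comp_hasDerivAt τ (h1.mul h2)
  refine h3.congr_deriv ?_
  set E := NormedSpace.exp (-(τ : ℂ) • Matrix.fromBlocks H D 0 H)
  have h4 : (Matrix.fromBlocks H D 0 H * E).toBlocks₁₂ = H * E.toBlocks₁₂ + D * E.toBlocks₂₂ := by
    rw [← Matrix.fromBlocks_toBlocks E, Matrix.fromBlocks_multiply]
    simp
  change ((_ * H * E.toBlocks₁₂ + _ * (-(Matrix.fromBlocks H D 0 H * E).toBlocks₁₂)) * K).trace = _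
  rw [h4, ← Matrix.trace_neg]
  congr 1
  noncomm_ring

-- With `A = exp (-βH/2)` self-adjoint and invertible, the trace is that of `Aᴴ * A`, which vanishes
-- only for `A = 0`.
open scoped ComplexOrder in
theorem Matrix.trace_exp_neg_ne_zero [Nonempty ι] {H : Matrix ι ι ℂ} (hH : H.IsHermitian) (β : ℝ) :
    (NormedSpace.exp (-(β : ℂ) • H)).trace ≠ 0 := by
  set A := NormedSpace.exp (-((β / 2 : ℝ) : ℂ) • H) with hA
  have h1 : A.conjTranspose = A := by
    refine Matrix.IsHermitian.exp ?_
    rw [Matrix.IsHermitian, Matrix.conjTranspose_smul, hH.eq]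
    simp
  have h2 : NormedSpace.exp (-(β : ℂ) • H) = A.conjTranspose * A := by
    rw [h1, hA, ← Matrix.exp_add_of_commute _ _ (Commute.refl _), ← add_smul]
    congr 2
    push_cast
    ring
  rw [h2, Ne, Matrix.trace_conjTranspose_mul_self_eq_zero_iff]
  intro h
  have h3 := Matrix.isUnit_exp (-((β / 2 : ℝ) : ℂ) • H)
  rw [← hA, h] at h3
  exact not_isUnit_zero h3

theorem Matrix.exp_smul_mul_exp_neg_smul (H : Matrix ι ι ℂ) (τ : ℂ) :
    NormedSpace.exp (τ • H) * NormedSpace.exp (-τ • H) = 1 := by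
  rw [← Matrix.exp_add_of_commute _ _ (((Commute.refl H).smul_left _).smul_right _), ← add_smul,
    add_neg_cancel, zero_smul, NormedSpace.exp_zero]

theorem Matrix.commute_exp_smul (H : Matrix ι ι ℂ) (τ : ℂ) :
    Commute H (NormedSpace.exp (τ • H)) :=
  ((Commute.refl H).smul_right τ).exp_right

theorem Matrix.commute_exp_smul_exp_smul (H : Matrix ι ι ℂ) (σ τ : ℂ) :
    Commute (NormedSpace.exp (σ • H)) (NormedSpace.exp (τ • H)) :=
  (((Commute.refl H).smul_left σ).smul_right τ).exp

theorem continuous_thermalAverage_imagTimeEvolve (H O : Matrix ι ι ℂ) (β : ℝ) :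
    Continuous fun τ : ℝ => thermalAverage H β (imagTimeEvolve H τ O * O) := by
  have h1 := Matrix.continuous_exp_smul H
  have h2 : Continuous fun τ : ℝ => NormedSpace.exp (-(τ : ℂ) • H) := by
    simpa only [neg_smul, smul_neg] using Matrix.continuous_exp_smul (-H)
  unfold thermalAverage imagTimeEvolve
  refine Continuous.div_const ?_ _
  exact ((((h1.mul continuous_const).mul h2).mul continuous_const).mul
    continuous_const).matrix_trace

theorem energySusceptibility_eq (H₀ H₁ : Matrix ι ι ℂ) (lam β : ℝ) :
    energySusceptibility H₀ H₁ lam β =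
      integratedCorrelator (H₀ + (lam : ℂ) • H₁) β H₁ -
        β * thermalAverage (H₀ + (lam : ℂ) • H₁) β H₁ ^ 2 := by
  rw [energySusceptibility, intervalIntegral.integral_sub
    ((continuous_thermalAverage_imagTimeEvolve _ _ _).intervalIntegrable _ _)
    intervalIntegrable_const, intervalIntegral.integral_const, integratedCorrelator]
  simp

theorem thermalAverage_smul (H : Matrix ι ι ℂ) (β : ℝ) (c : ℂ) (O : Matrix ι ι ℂ) :
    thermalAverage H β (c • O) = c * thermalAverage H β O := by
  rw [thermalAverage, thermalAverage, Matrix.smul_mul, Matrix.trace_smul, smul_eq_mul,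
    mul_div_assoc]

theorem integratedCorrelator_smul (H : Matrix ι ι ℂ) (β : ℝ) (c : ℂ) (O : Matrix ι ι ℂ) :
    integratedCorrelator H β (c • O) = c ^ 2 * integratedCorrelator H β O := by
  rw [integratedCorrelator, integratedCorrelator, ← intervalIntegral.integral_const_mul]
  congr 1
  funext τ
  rw [← thermalAverage_smul]
  congr 1
  simp only [imagTimeEvolve, Matrix.mul_smul, Matrix.smul_mul, smul_smul, pow_two]

/-- Since `H(τ) = H`, the `H ^ 2` term and the mixed terms are independent of `τ`, and by cyclicity
both mixed terms equal `⟨D H⟩`. -/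
theorem integratedCorrelator_sub (H D : Matrix ι ι ℂ) (β : ℝ) :
    integratedCorrelator H β (H - D) =
      β * thermalAverage H β (H ^ 2) - 2 * β * thermalAverage H β (D * H) +
        integratedCorrelator H β D := by
  have key : ∀ τ : ℝ, thermalAverage H β (imagTimeEvolve H τ (H - D) * (H - D)) =
      (thermalAverage H β (H ^ 2) - 2 * thermalAverage H β (D * H)) +
        thermalAverage H β (imagTimeEvolve H τ D * D) := by
    intro τ
    simp only [thermalAverage, imagTimeEvolve]
    set W := NormedSpace.exp (-(β : ℂ) • H)
    set E := NormedSpace.exp ((τ : ℂ) • H)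
    set E' := NormedSpace.exp (-(τ : ℂ) • H)
    have hEE' : E * E' = 1 := Matrix.exp_smul_mul_exp_neg_smul H τ
    have hE'E : E' * E = 1 := mul_eq_one_comm.1 hEE'
    have hHE : H * E = E * H := Matrix.commute_exp_smul H τ
    have hHW : H * W = W * H := Matrix.commute_exp_smul H _
    have hWE : W * E = E * W := Matrix.commute_exp_smul_exp_smul H _ _
    have hEHE' : E * H * E' = H := by rw [← hHE, Matrix.mul_assoc, hEE', Matrix.mul_one]
    have h1 : (H * D * W).trace = (D * H * W).trace := by
      rw [Matrix.mul_assoc, Matrix.trace_mul_comm, Matrix.mul_assoc, ← hHW, Matrix.mul_assoc]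
    have h2 : (E * D * E' * H * W).trace = (D * H * W).trace := by
      rw [show E * D * E' * H * W = E * (D * E' * H * W) by noncomm_ring, Matrix.trace_mul_comm,
        show D * E' * H * W * E = D * (E' * (H * (W * E))) by noncomm_ring, hWE,
        show E' * (H * (E * W)) = E' * (H * E) * W by noncomm_ring, hHE,
        show E' * (E * H) * W = (E' * E) * (H * W) by noncomm_ring, hE'E, one_mul,
        Matrix.mul_assoc]
    have h3 : E * (H - D) * E' * (H - D) * W =
        H ^ 2 * W - H * D * W - E * D * E' * H * W + E * D * E' * D * W := by
      rw [show E * (H - D) * E' * (H - D) * W = (E * H * E') * (H - D) * W -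
        E * D * E' * (H - D) * W by noncomm_ring, hEHE']
      noncomm_ring
    rw [h3, Matrix.trace_add, Matrix.trace_sub, Matrix.trace_sub, h1, h2]
    ring
  rw [integratedCorrelator]
  simp only [key]
  rw [intervalIntegral.integral_add intervalIntegrable_const
    ((continuous_thermalAverage_imagTimeEvolve _ _ _).intervalIntegrable _ _),
    intervalIntegral.integral_const, integratedCorrelator]
  simp only [sub_zero, Complex.real_smul]
  ring

end Duhamel

/-! ### The integrated correlator of the diagonal part, and the reality of the energies. -/

namespace PMR

variable {ι : Type*} [Fintype ι] [DecidableEq ι] {M : ℕ} (P : PMR ι M)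

/-- The block matrix `[[H, D₀], [0, H]]`. -/
def duhamelBlock : Matrix (ι ⊕ ι) (ι ⊕ ι) ℂ := Matrix.fromBlocks P.matrix P.diagPart 0 P.matrix

theorem duhamelBlock_pow (n : ℕ) :
    P.duhamelBlock ^ n = Matrix.fromBlocks (P.matrix ^ n) (P.insertedPow n) 0 (P.matrix ^ n) := by
  induction n with
  | zero => simp [insertedPow]
  | succ n ih =>
    rw [pow_succ', ih, duhamelBlock, Matrix.fromBlocks_multiply]
    simp [insertedPow, pow_succ']

theorem toBlocks₂₂_exp_duhamelBlock (t : ℂ) :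
    (NormedSpace.exp (t • P.duhamelBlock)).toBlocks₂₂ = NormedSpace.exp (t • P.matrix) := by
  ext i j
  refine (Matrix.hasSum_exp_apply P.duhamelBlock t (Sum.inr i) (Sum.inr j)).unique
    ((Matrix.hasSum_exp_apply P.matrix t i j).congr_fun fun n => ?_)
  rw [duhamelBlock_pow, Matrix.fromBlocks_apply₂₂]

theorem hasSum_trace_mul_insertedPow (Φ : Matrix ι ι ℂ) (t : ℂ) :
    HasSum (fun n : ℕ => t ^ n / n.factorial * (Φ * P.insertedPow n).trace)
      (Φ * (NormedSpace.exp (t • P.duhamelBlock)).toBlocks₁₂).trace := by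
  simp only [Matrix.trace, Matrix.diag, Matrix.mul_apply, Finset.mul_sum]
  refine hasSum_sum fun i _ => hasSum_sum fun j _ => ?_
  refine ((Matrix.hasSum_exp_apply P.duhamelBlock t (Sum.inl j) (Sum.inr i)).mul_left
    (Φ i j)).congr_fun fun n => ?_
  rw [duhamelBlock_pow, Matrix.fromBlocks_apply₁₂]
  ring

/-- The block exponential gives a primitive of the correlator. It vanishes at `0`, where the
exponential is the identity, and at `β` the factor `exp (βH)` cancels the thermal weight by
cyclicity. -/
theorem integratedCorrelator_diagPart (β : ℝ) :
    integratedCorrelator P.matrix β P.diagPart =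
      -(P.diagPart * (NormedSpace.exp (-(β : ℂ) • P.duhamelBlock)).toBlocks₁₂).trace /
        (NormedSpace.exp (-(β : ℂ) • P.matrix)).trace := by
  set K := P.diagPart * NormedSpace.exp (-(β : ℂ) • P.matrix) with hK
  set Z := (NormedSpace.exp (-(β : ℂ) • P.matrix)).trace with hZ
  have hderiv : ∀ τ : ℝ, HasDerivAt (fun τ : ℝ => -((NormedSpace.exp ((τ : ℂ) • P.matrix) *
      (NormedSpace.exp (-(τ : ℂ) • P.duhamelBlock)).toBlocks₁₂ * K).trace) / Z)
      (thermalAverage P.matrix β (imagTimeEvolve P.matrix τ P.diagPart * P.diagPart)) τ := by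
    intro τ
    refine ((Matrix.hasDerivAt_exp_mul_block P.matrix P.diagPart K τ).neg.div_const Z).congr_deriv ?_
    rw [neg_neg, ← duhamelBlock, toBlocks₂₂_exp_duhamelBlock, thermalAverage, imagTimeEvolve, hK,
      ← hZ]
    simp only [Matrix.mul_assoc]
  rw [integratedCorrelator, intervalIntegral.integral_eq_sub_of_hasDerivAt
    (fun τ _ => hderiv τ)
    ((continuous_thermalAverage_imagTimeEvolve _ _ _).intervalIntegrable _ _)]
  have h0 : (NormedSpace.exp (-((0 : ℝ) : ℂ) • P.duhamelBlock)).toBlocks₁₂ = 0 := by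
    rw [Complex.ofReal_zero, neg_zero, zero_smul, NormedSpace.exp_zero]
    ext i j
    simp [Matrix.toBlocks₁₂]
  rw [h0, Matrix.mul_zero, Matrix.zero_mul, Matrix.trace_zero, neg_zero, zero_div, sub_zero]
  congr 2
  rw [Matrix.mul_assoc, Matrix.trace_mul_comm, hK, Matrix.mul_assoc, Matrix.mul_assoc,
    mul_eq_one_comm.1 (Matrix.exp_smul_mul_exp_neg_smul P.matrix β), Matrix.mul_one,
    Matrix.trace_mul_comm]

omit [Fintype ι] in
theorem permOp_apply_self (j : Fin M) (z : ι) : permOp (P.perm j) z z = 0 := by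
  have h : (P.perm j)⁻¹ z ≠ z := fun h => P.perm_ne_one j
    (inv_eq_one.1 (eq_one_of_apply_eq_self (P.group.inv_mem (P.perm_mem j)) h))
  simpa [permOp, PEquiv.toMatrix_apply] using h

variable {P}

/-- The `P j` have no fixed points, so the diagonal of `H` is that of `D₀`, and a Hermitian matrix
has a real diagonal. -/
theorem ofReal_re_diag0 (hP : P.matrix.IsHermitian) (z : ι) :
    ((P.diag0 z).re : ℂ) = P.diag0 z := by
  have h1 : P.matrix z z = P.diag0 z := by
    rw [matrix, Matrix.add_apply, Matrix.sum_apply, Finset.sum_eq_zero, add_zero, diagPart,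
      Matrix.diagonal_apply_eq]
    intro j _
    rw [Matrix.diagonal_mul, permOp_apply_self, mul_zero]
  rw [← Complex.conj_eq_iff_re, ← h1]
  exact hP.apply z z

end PMR

/-! ### From traces to estimators. -/

namespace Config

variable {ι : Type*} [Fintype ι] [DecidableEq ι] {M : ℕ} {P : PMR ι M}

theorem dde_ne_zero (hP : P.matrix.IsHermitian) {β : ℝ} (hβ : 0 < β) (C : Config P) (k : ℕ) :
    C.dde β k ≠ 0 := by
  have h := expDividedDifference_ne_zero (neg_ne_zero.2 hβ.ne') (fun i => (C.energy i).re) k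
  simp only [energy, PMR.ofReal_re_diag0 hP, Complex.ofReal_neg] at h
  exact h

omit [Fintype ι] [DecidableEq ι] in
theorem energy_q (C : Config P) : C.energy C.q = C.energy 0 := by
  rw [energy, energy, state, C.closed]
  rfl

theorem estimates_of_hasSum [Nonempty ι] (hP : P.matrix.IsHermitian) {β : ℝ} {F : Config P → ℂ}
    {S v : ℂ} (hF : HasSum (fun C : Config P => C.weight β * F C) S)
    (hv : v = S / (NormedSpace.exp (-(β : ℂ) • P.matrix)).trace) : Estimates P β F v := by
  have hZ : HasSum (fun C : Config P => C.weight β)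
      (NormedSpace.exp (-(β : ℂ) • P.matrix)).trace := by
    have h := hasSum_trace_of_pow P (fun _ => 1) β 0 fun C => C.hasSum_dde β C.q
    rw [pow_zero, Matrix.diagonal_one, Matrix.one_mul, Matrix.one_mul] at h
    exact h.congr_fun fun C => (one_mul _).symm
  refine ⟨hZ.summable, hF.summable, ?_, ?_⟩
  · rw [hZ.tsum_eq]
    exact Matrix.trace_exp_neg_ne_zero hP β
  · rw [configAverage, hZ.tsum_eq, hF.tsum_eq, hv]

omit [Fintype ι] [DecidableEq ι] in
theorem dde_mul_ratio1 {β : ℝ} (C : Config P) (h : C.dde β C.q ≠ 0) :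
    C.dde β C.q * C.ratio1 β = C.ddeDeriv β C.q - C.energy C.q * C.dde β C.q := by
  rw [ratio1, ddeDeriv]
  split_ifs
  · field_simp
    ring
  · ring

omit [Fintype ι] [DecidableEq ι] in
theorem dde_mul_energySqEstimator {β : ℝ} (C : Config P) (h : C.dde β C.q ≠ 0) :
    C.dde β C.q * C.energySqEstimator β = C.ddeDeriv2 β C.q := by
  rw [energySqEstimator, ratio1, ratio2, ddeDeriv2, ddeDeriv, ddeDeriv]
  rcases Nat.lt_trichotomy C.q 1 with h1 | h1 | h1
  · simp only [show ¬ 1 ≤ C.q by omega, show ¬ 2 ≤ C.q by omega, if_false]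
    ring
  · simp only [show 1 ≤ C.q by omega, show ¬ 2 ≤ C.q by omega, show ¬ 1 ≤ C.q - 1 by omega,
      if_false, if_true]
    field_simp
    ring
  · simp only [show 1 ≤ C.q by omega, show 2 ≤ C.q by omega, show 1 ≤ C.q - 1 by omega, if_true,
      show C.q - 1 - 1 = C.q - 2 by omega]
    field_simp
    ring

omit [Fintype ι] [DecidableEq ι] in
theorem dde_mul_diagEstimator {β : ℝ} (C : Config P) (h : C.dde β C.q ≠ 0) :
    C.dde β C.q * C.diagEstimator β =
      -(C.energy 0 * (-β * C.ddeDeriv β C.q - C.q * C.dde β C.q)) := by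
  rw [diagEstimator, ddeDeriv, energy_q]
  rcases Nat.eq_zero_or_pos C.q with h1 | h1
  · simp only [show ¬ 0 < C.q by omega, show ¬ 1 ≤ C.q by omega, if_false]
    ring
  · simp only [show 0 < C.q by omega, show 1 ≤ C.q by omega, if_true]
    field_simp
    ring

section HasSum

variable (hP : P.matrix.IsHermitian) {β : ℝ} (hβ : 0 < β)
include hP hβ

theorem hasSum_weight_mul_diagEstimator :
    HasSum (fun C : Config P => C.weight β * C.diagEstimator β)
      (-(P.diagPart * (NormedSpace.exp (-(β : ℂ) • P.duhamelBlock)).toBlocks₁₂).trace) := by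
  refine (hasSum_trace_insertedPow P P.diag0 β
    (P.hasSum_trace_mul_insertedPow P.diagPart (-β))).neg.congr_fun fun C => ?_
  rw [weight, mul_assoc, dde_mul_diagEstimator C (C.dde_ne_zero hP hβ _)]
  change _ = -(C.energy 0 * _)
  ring

theorem hasSum_weight_mul_ratio1 :
    HasSum (fun C : Config P => C.weight β * C.ratio1 β)
      ((P.matrix - P.diagPart) * NormedSpace.exp (-(β : ℂ) • P.matrix)).trace := by
  have h1 := hasSum_trace_of_pow P (fun _ => 1) β 1 fun C => C.hasSum_ddeDeriv β C.q
  have h2 := hasSum_trace_of_pow P P.diag0 β 0 fun C => C.hasSum_dde β C.q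
  have h3 := h1.sub h2
  rw [Matrix.diagonal_one, pow_one, Matrix.one_mul, pow_zero, Matrix.mul_one, ← Matrix.trace_sub,
    ← Matrix.sub_mul] at h3
  refine h3.congr_fun fun C => ?_
  rw [weight, mul_assoc, dde_mul_ratio1 C (C.dde_ne_zero hP hβ _), energy_q]
  change _ = _ - C.energy 0 * _
  ring

theorem hasSum_weight_mul_energySqEstimator :
    HasSum (fun C : Config P => C.weight β * C.energySqEstimator β)
      (P.matrix ^ 2 * NormedSpace.exp (-(β : ℂ) • P.matrix)).trace := by
  have h1 := hasSum_trace_of_pow P (fun _ => 1) β 2 fun C => C.hasSum_ddeDeriv2 β C.q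
  rw [Matrix.diagonal_one, Matrix.one_mul] at h1
  refine h1.congr_fun fun C => ?_
  rw [weight, mul_assoc, dde_mul_energySqEstimator C (C.dde_ne_zero hP hβ _), one_mul]

theorem hasSum_weight_mul_diagEnergyEstimator :
    HasSum (fun C : Config P => C.weight β * C.diagEnergyEstimator β)
      (P.diagPart * P.matrix * NormedSpace.exp (-(β : ℂ) • P.matrix)).trace := by
  have h1 := hasSum_trace_of_pow P P.diag0 β 1 fun C => C.hasSum_ddeDeriv β C.q
  rw [pow_one] at h1
  refine h1.congr_fun fun C => ?_
  have h2 := dde_mul_ratio1 C (C.dde_ne_zero hP hβ C.q)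
  rw [energy_q] at h2
  rw [weight, diagEnergyEstimator]
  change _ = C.energy 0 * _
  linear_combination C.hopping * C.energy 0 * h2

theorem hasSum_weight_mul_offDiagEstimator :
    HasSum (fun C : Config P => C.weight β * C.offDiagEstimator β)
      (β * (P.matrix ^ 2 * NormedSpace.exp (-(β : ℂ) • P.matrix)).trace +
        -(P.diagPart * (NormedSpace.exp (-(β : ℂ) • P.duhamelBlock)).toBlocks₁₂).trace -
        2 * β * (P.diagPart * P.matrix * NormedSpace.exp (-(β : ℂ) • P.matrix)).trace) := by
  refine ((((hasSum_weight_mul_energySqEstimator hP hβ).mul_left (β : ℂ)).add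
    (hasSum_weight_mul_diagEstimator hP hβ)).sub
    ((hasSum_weight_mul_diagEnergyEstimator hP hβ).mul_left (2 * β : ℂ))).congr_fun fun C => ?_
  rw [offDiagEstimator]
  ring

end HasSum

omit [Fintype ι] [DecidableEq ι] in
theorem hasSum_const_mul {F : Config P → ℂ} {β : ℝ} {S : ℂ} (c : ℂ)
    (h : HasSum (fun C : Config P => C.weight β * F C) S) :
    HasSum (fun C : Config P => C.weight β * (c * F C)) (c * S) :=
  (h.mul_left c).congr_fun fun C => by ring

section Estimates

variable [Nonempty ι] (hP : P.matrix.IsHermitian) {β : ℝ} (hβ : 0 < β) (c : ℂ)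
include hP

theorem estimates_energy : Estimates P β (fun C => c * C.energy 0)
    (thermalAverage P.matrix β (c • P.diagPart)) := by
  have h1 : HasSum (fun C : Config P => C.weight β * C.energy 0)
      (P.diagPart * NormedSpace.exp (-(β : ℂ) • P.matrix)).trace := by
    have h2 := hasSum_trace_of_pow P P.diag0 β 0 fun C => C.hasSum_dde β C.q
    rw [pow_zero, Matrix.mul_one] at h2
    exact h2.congr_fun fun C => mul_comm _ _
  refine estimates_of_hasSum hP (hasSum_const_mul c h1) ?_
  rw [thermalAverage_smul, thermalAverage, mul_div_assoc]

include hβ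

theorem estimates_diagEstimator : Estimates P β (fun C => c ^ 2 * C.diagEstimator β)
    (integratedCorrelator P.matrix β (c • P.diagPart)) := by
  refine estimates_of_hasSum hP (hasSum_const_mul _ (hasSum_weight_mul_diagEstimator hP hβ)) ?_
  rw [integratedCorrelator_smul, P.integratedCorrelator_diagPart, mul_div_assoc]

theorem estimates_ratio1 : Estimates P β (fun C => c * C.ratio1 β)
    (thermalAverage P.matrix β (c • (P.matrix - P.diagPart))) := by
  refine estimates_of_hasSum hP (hasSum_const_mul _ (hasSum_weight_mul_ratio1 hP hβ)) ?_
  rw [thermalAverage_smul, thermalAverage, mul_div_assoc]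

theorem estimates_offDiagEstimator : Estimates P β (fun C => c ^ 2 * C.offDiagEstimator β)
    (integratedCorrelator P.matrix β (c • (P.matrix - P.diagPart))) := by
  refine estimates_of_hasSum hP (hasSum_const_mul _ (hasSum_weight_mul_offDiagEstimator hP hβ)) ?_
  rw [integratedCorrelator_smul, integratedCorrelator_sub, P.integratedCorrelator_diagPart,
    thermalAverage, thermalAverage]
  ring

end Estimates

end Config

/-! ### Evaluation on the register machine -/

/-- Started in the state `s`, the program halts with output `out` within `K` steps. -/
inductive RunsTo (prog : List Instr) (m : InputMemory) (out : ℂ) : ℕ → MachineState → Prop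
  | halt {K : ℕ} {s : MachineState} (h : prog[s.pc]? = some Instr.halt) (hout : s.scal 0 = out) :
      RunsTo prog m out K s
  | step {K : ℕ} {s s' : MachineState} (h : machineStep prog m s = some s')
      (h' : RunsTo prog m out K s') : RunsTo prog m out (K + 1) s

namespace RunsTo

variable {prog : List Instr} {m : InputMemory} {out : ℂ} {K : ℕ} {s : MachineState}

theorem outputsWithin_add {n : ℕ} (h : RunsTo prog m out K s) (hs : machineRun prog m n = some s) :
    OutputsWithin prog m (n + K) out := by
  induction h generalizing n with
  | halt h hout => exact ⟨n, Nat.le_add_right _ _, _, hs, h, hout⟩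
  | @step K s s' h h' ih =>
    have h1 := ih (n := n + 1) (by rw [machineRun, hs, Option.bind_some, h])
    rwa [add_right_comm, add_assoc] at h1

theorem outputsWithin (h : RunsTo prog m out K MachineState.init) :
    OutputsWithin prog m K out := by
  have := h.outputsWithin_add (n := 0) rfl
  rwa [zero_add] at this

theorem exec {i : Instr} {s' : MachineState} (hi : prog[s.pc]? = some i)
    (h : i.exec m s = some s') (h' : RunsTo prog m out K s') : RunsTo prog m out (K + 1) s :=
  step (by rw [machineStep, hi]; exact h) h'

theorem loadEnergy {r a : ℕ} (hi : prog[s.pc]? = some (.loadEnergy r a)) (ha : s.nat a ≤ m.q)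
    (h' : RunsTo prog m out K (s.setScal r (m.energy (s.nat a)))) :
    RunsTo prog m out (K + 1) s :=
  exec hi (if_pos ha) h'

theorem loadDDE {r a : ℕ} (hi : prog[s.pc]? = some (.loadDDE r a)) (ha : s.nat a ≤ m.q)
    (h' : RunsTo prog m out K (s.setScal r (m.dde (s.nat a)))) :
    RunsTo prog m out (K + 1) s :=
  exec hi (if_pos ha) h'

theorem div {r a b : ℕ} (hi : prog[s.pc]? = some (.div r a b)) (hb : s.scal b ≠ 0)
    (h' : RunsTo prog m out K (s.setScal r (s.scal a / s.scal b))) :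
    RunsTo prog m out (K + 1) s :=
  exec hi (if_neg hb) h'

end RunsTo

/-- A straight-line program that computes the quantities from which the estimators are made. -/
def estimatorProgram : List Instr :=
  [.loadOrder 0, .natConst 1 1, .natSub 2 0 1, .natSub 3 2 1, .natSub 4 0 2, .natSub 5 2 3,
    .loadBeta 1, .loadCoupling 2, .loadEnergy 3 9, .loadEnergy 4 0, .loadEnergy 5 2,
    .loadDDE 6 0, .loadDDE 7 2, .loadDDE 8 3, .ofNat 9 0, .ofNat 10 4, .ofNat 11 5,
    .div 7 7 6, .mul 7 7 10, .div 8 8 6, .mul 8 8 11,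
    .mul 12 1 3, .mul 13 12 3, .mul 14 9 3, .mul 15 12 7, .add 16 13 14, .add 16 16 15,
    .mul 17 4 4, .add 18 4 5, .mul 18 18 7, .add 17 17 18, .add 17 17 8, .mul 17 1 17,
    .add 17 17 16, .add 19 3 7, .mul 19 12 19, .sub 17 17 19, .sub 17 17 19]

theorem runsTo_estimatorProgram {ι : Type*} {M : ℕ} {P : PMR ι M} (C : Config P) (β c : ℝ)
    (hC : C.dde β C.q ≠ 0) (tail : List Instr) (K : ℕ) (out : ℂ)
    (h : ∀ s : MachineState, s.pc = 38 → s.scal 2 = c → s.scal 3 = C.energy 0 →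
      s.scal 7 = C.ratio1 β → s.scal 16 = C.diagEstimator β →
      s.scal 17 = C.offDiagEstimator β → s.scal 20 = 0 →
      RunsTo (estimatorProgram ++ tail) (C.memory β c) out K s) :
    RunsTo (estimatorProgram ++ tail) (C.memory β c) out (K + 38) MachineState.init := by
  -- With truncated subtraction, `q - (q - 1)` is the indicator of `q ≥ 1`, and in `hR2` the
  -- analogous difference is that of `q ≥ 2`. The addresses stay within `0, …, q`, so the program
  -- needs no jump.
  have hR1 : C.dde β (C.q - 1) / C.dde β C.q * ((C.q : ℂ) - (C.q - 1 : ℕ)) = C.ratio1 β := by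
    rw [Config.ratio1]
    split_ifs with h1
    · rw [Nat.cast_sub h1]
      simp
    · simp [show C.q = 0 by omega]
  have hR2 : C.dde β (C.q - 1 - 1) / C.dde β C.q * (((C.q - 1 : ℕ) : ℂ) - (C.q - 1 - 1 : ℕ)) =
      C.ratio2 β := by
    rw [Config.ratio2]
    split_ifs with h1
    · rw [Nat.cast_sub (show 1 ≤ C.q - 1 by omega), Nat.sub_sub]
      simp
    · simp [show C.q - 1 = 0 by omega]
  have hA : C.diagEstimator β =
      β * C.energy 0 * C.energy 0 + C.q * C.energy 0 + β * C.energy 0 * C.ratio1 β := by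
    rw [Config.diagEstimator, Config.ratio1]
    split_ifs with h1 h2 h2
    · ring
    · exact absurd h1 h2
    · exact absurd h2 h1
    · ring
  iterate 8 refine RunsTo.exec rfl rfl ?_
  -- The address register `9` used for `E_{z_0}` is never written and still holds `0`.
  iterate 3
    refine RunsTo.loadEnergy rfl (by simp [MachineState.setNat, MachineState.setScal, MachineState.init, Config.memory]) ?_
  iterate 3
    refine RunsTo.loadDDE rfl (by
        simp [MachineState.setNat, MachineState.setScal, MachineState.init, Config.memory]
        try omega) ?_
  iterate 3 refine RunsTo.exec rfl rfl ?_
  refine RunsTo.div rfl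
    (by simpa [MachineState.setNat, MachineState.setScal, MachineState.init, Config.memory]
      using hC) ?_
  refine RunsTo.exec rfl rfl ?_
  refine RunsTo.div rfl
    (by simpa [MachineState.setNat, MachineState.setScal, MachineState.init, Config.memory]
      using hC) ?_
  iterate 18 refine RunsTo.exec rfl rfl ?_
  refine h _ rfl ?_ ?_ ?_ ?_ ?_ ?_
  all_goals simp [MachineState.setNat, MachineState.setScal, MachineState.init, Config.memory,
    show C.q ≤ C.q + 1 + 1 by omega]
  · exact hR1
  · rw [hR1, hA]
  · rw [hR1, hR2, ← hA, Config.offDiagEstimator, Config.energySqEstimator,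
      Config.diagEnergyEstimator]
    ring

/-- One common prefix of `38` instructions computes all the building blocks; an estimator then only
needs a short tail. -/
theorem computableInConstantTime_of_tail
    {F : ∀ {ι : Type u} {M : ℕ} (P : PMR ι M), ℝ → ℝ → Config P → ℂ} (tail : List Instr) (K : ℕ)
    (h : ∀ {ι : Type u} {M : ℕ} (P : PMR ι M) (β c : ℝ) (C : Config P) (s : MachineState),
      s.pc = 38 → s.scal 2 = c → s.scal 3 = C.energy 0 →
      s.scal 7 = C.ratio1 β → s.scal 16 = C.diagEstimator β →
      s.scal 17 = C.offDiagEstimator β → s.scal 20 = 0 →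
      RunsTo (estimatorProgram ++ tail) (C.memory β c) (F P β c C) K s) :
    ComputableInConstantTime.{u} F :=
  ⟨estimatorProgram ++ tail, K + 38, fun _ _ _ _ _ P hP β hβ c C =>
    (runsTo_estimatorProgram C β c (C.dde_ne_zero hP hβ _) tail K _ (h P β c C)).outputsWithin⟩

theorem computable_diagEstimator :
    ComputableInConstantTime.{u} (fun _ β _ C => C.diagEstimator β) := by
  -- Scalar register `20` is still `0`, so the addition copies the result to the output register.
  refine computableInConstantTime_of_tail [.add 0 16 20, .halt] 1 ?_
  rintro ι M P β c C ⟨pc, nat, scal⟩ rfl h2 h3 h7 h16 h17 h20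
  refine .exec rfl rfl (.halt rfl ?_)
  simp_all [MachineState.setScal]

theorem computable_sq_mul_diagEstimator :
    ComputableInConstantTime.{u} (fun _ β c C => (c : ℂ) ^ 2 * C.diagEstimator β) := by
  refine computableInConstantTime_of_tail [.mul 0 2 16, .mul 0 2 0, .halt] 2 ?_
  rintro ι M P β c C ⟨pc, nat, scal⟩ rfl h2 h3 h7 h16 h17 h20
  refine .exec rfl rfl (.exec rfl rfl (.halt rfl ?_))
  simp_all [MachineState.setScal]
  ring

theorem computable_mul_energy :
    ComputableInConstantTime.{u} (fun _ _ c C => (c : ℂ) * C.energy 0) := by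
  refine computableInConstantTime_of_tail [.mul 0 2 3, .halt] 1 ?_
  rintro ι M P β c C ⟨pc, nat, scal⟩ rfl h2 h3 h7 h16 h17 h20
  refine .exec rfl rfl (.halt rfl ?_)
  simp_all [MachineState.setScal]

theorem computable_sq_mul_offDiagEstimator :
    ComputableInConstantTime.{u} (fun _ β c C => (c : ℂ) ^ 2 * C.offDiagEstimator β) := by
  refine computableInConstantTime_of_tail [.mul 0 2 17, .mul 0 2 0, .halt] 2 ?_
  rintro ι M P β c C ⟨pc, nat, scal⟩ rfl h2 h3 h7 h16 h17 h20
  refine .exec rfl rfl (.exec rfl rfl (.halt rfl ?_))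
  simp_all [MachineState.setScal]
  ring

theorem computable_mul_ratio1 :
    ComputableInConstantTime.{u} (fun _ β c C => (c : ℂ) * C.ratio1 β) := by
  refine computableInConstantTime_of_tail [.mul 0 2 7, .halt] 1 ?_
  rintro ι M P β c C ⟨pc, nat, scal⟩ rfl h2 h3 h7 h16 h17 h20
  refine .exec rfl rfl (.halt rfl ?_)
  simp_all [MachineState.setScal]

theorem theorem1 :
    -- exact estimators, for every Hamiltonian in PMR form and every inverse temperature
    (∀ (ι : Type u) [Fintype ι] [DecidableEq ι] [Nonempty ι] (M : ℕ) (P : PMR ι M),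
      P.matrix.IsHermitian → ∀ β : ℝ, 0 < β →
        -- the denominators do not vanish
        (∀ C : Config P, C.dde β C.q ≠ 0) ∧
        Estimates P β (fun C => C.diagEstimator β)
          (integratedCorrelator P.matrix β P.diagPart) ∧
        -- the energy susceptibility for the two kinds of driving terms
        ∀ (H₀ H₁ : Matrix ι ι ℂ) (lam c : ℝ), P.matrix = H₀ + (lam : ℂ) • H₁ →
          (H₁ = (c : ℂ) • P.diagPart →
            Estimates P β (fun C => (c : ℂ) ^ 2 * C.diagEstimator β)
              (integratedCorrelator P.matrix β H₁) ∧
            Estimates P β (fun C => (c : ℂ) * C.energy 0) (thermalAverage P.matrix β H₁) ∧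
            energySusceptibility H₀ H₁ lam β =
              configAverage P β (fun C => (c : ℂ) ^ 2 * C.diagEstimator β)
                - β * configAverage P β (fun C => (c : ℂ) * C.energy 0) ^ 2) ∧
          (H₁ = (c : ℂ) • (P.matrix - P.diagPart) →
            Estimates P β (fun C => (c : ℂ) ^ 2 * C.offDiagEstimator β)
              (integratedCorrelator P.matrix β H₁) ∧
            Estimates P β (fun C => (c : ℂ) * C.ratio1 β) (thermalAverage P.matrix β H₁) ∧
            energySusceptibility H₀ H₁ lam β =
              configAverage P β (fun C => (c : ℂ) ^ 2 * C.offDiagEstimator β)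
                - β * configAverage P β (fun C => (c : ℂ) * C.ratio1 β) ^ 2)) ∧
    -- all the configuration functions involved are computable in time `O(1)`
    ComputableInConstantTime.{u} (fun _ β _ C => C.diagEstimator β) ∧
    ComputableInConstantTime.{u} (fun _ β c C => (c : ℂ) ^ 2 * C.diagEstimator β) ∧
    ComputableInConstantTime.{u} (fun _ _ c C => (c : ℂ) * C.energy 0) ∧
    ComputableInConstantTime.{u} (fun _ β c C => (c : ℂ) ^ 2 * C.offDiagEstimator β) ∧
    ComputableInConstantTime.{u} (fun _ β c C => (c : ℂ) * C.ratio1 β) := by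
  refine ⟨?_, computable_diagEstimator, computable_sq_mul_diagEstimator, computable_mul_energy,
    computable_sq_mul_offDiagEstimator, computable_mul_ratio1⟩
  intro ι _ _ _ M P hP β hβ
  refine ⟨fun C => C.dde_ne_zero hP hβ _, ?_, fun H₀ H₁ lam c hH => ⟨?_, ?_⟩⟩
  · simpa using Config.estimates_diagEstimator hP hβ 1
  · rintro rfl
    have h1 := Config.estimates_diagEstimator hP hβ (c : ℂ)
    have h2 := Config.estimates_energy hP (β := β) (c : ℂ)
    refine ⟨h1, h2, ?_⟩
    rw [energySusceptibility_eq, ← hH, h1.2.2.2, h2.2.2.2]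
  · intro h
    have h1 := Config.estimates_offDiagEstimator hP hβ (c : ℂ)
    have h2 := Config.estimates_ratio1 hP hβ (c : ℂ)
    rw [← h] at h1 h2
    refine ⟨h1, h2, ?_⟩
    rw [energySusceptibility_eq, ← hH, h1.2.2.2, h2.2.2.2]
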